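/- **Corollary (Differential Privacy).** Let $\sigma$ be a monad-free simple type, let $\tau$ be a basic type or a type of symbolic distributions, let $\Phi$ be a relational assertion in the two variables $x_\triangleleft,x_\triangleright:\sigma$, let $\epsilon:\mathbb R^+$ and $\delta:\overline{\mathbb R}^+$ be closed expressions, and let $e$ be a closed PrivInfer expression of type $\sigma\to\mathfrak M[\tau]$. If $$\vdash e\sim e :: \{x::\sigma\mid\Phi\}\to \mathfrak M_{\epsilon\text{-}\mathsf D,\delta}\{y::\tau\mid y_\triangleleft=y_\triangleright\}$$ is derivable in the relational type system below, then for all $d,d'\in[\![\sigma]\!]$ such that $[\![\Phi]\!]$ holds at $x_\triangleleft\mapsto d,\ x_\triangleright\mapsto d'$, and for every $S\subseteq[\![\tau]\!]$, $$\Pr([\![e]\!](d)\in S)\le e^{[\![\epsilon]\!]}\,\Pr([\![e]\!](d')\in S)+[\![\delta]\!].$$ That is, $[\![e]\!]$ is $([\![\epsilon]\!],[\![\delta]\!])$-differentially private for the adjacency relation $[\![\Phi]\!]$. *Types and semantics.* Basic types $\beta$ are unit, booleans $\mathbb B$, $\mathbb N$, $\mathbb R$, $\mathbb R^+=[0,\infty)$,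 $\overline{\mathbb R}^+=[0,\infty]$, $[0,1]$ and lists of basic types. Simple types are generated from $\beta$, the types $\mathfrak D[\beta]$ of symbolic distributions, and $\mathfrak M[v]$ for $v=\beta$ or $v=\mathfrak D[\beta]$, by $\to$. Arrows denote full function spaces and $\mathfrak M[v]$ the discrete probability distributions on $[\![v]\!]$. The elements of $[\![\mathfrak D[\beta]]\!]$ are the symbols $\mathsf{uniform}$, $\mathsf{beta}(a,b)$ ($\beta=[0,1]$), $\mathsf{bernoulli}(p)$ ($\beta=\mathbb B$), $\mathsf{normal}(m,v)$ with $v$ the variance ($\beta=\mathbb R$) and, for $\beta\ne\mathbb B$, one symbol for each discrete distribution on $[\![\beta]\!]$. Expressions are the simply typed terms built from variables, constants (all elements of monad-free types), application, $\lambda$, $\mathsf{letrec}$, $\mathsf{case}$ on $\mathbb B$, $\mathbb N$ and lists, monadic unit and bind, $\mathsf{observe}\,x\Rightarrow t\,\mathsf{in}\,u$, $\mathsf{infer}$, $\mathsf{ran}$, $\mathsf{getParams}$, the symbolic distributions, and $\mathsf{lapMech}(\epsilon,v)$, $\mathsf{gaussMech}(s,v)$, $\mathsf{expMech}(\epsilon,q,d)$.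 Here $\mathsf{letrec}$ is a fixed point; $\mathsf{observe}$ conditions the prior $u$ on the probabilistic predicate $t$ and renormalizes; $\mathsf{ran}$ maps a symbol to its distribution; $\mathsf{lapMech}$ adds Laplace noise of scale $1/\epsilon$ and $\mathsf{gaussMech}$ adds Gaussian noise of standard deviation $s$; $\mathsf{expMech}$ returns $r$ with probability proportional to $\exp(q(d,r)\epsilon/2)$. Continuous distributions are replaced by their discretizations (rounding down to the grid $2^{-n}\mathbb Z$), at an arbitrary precision $n$. Operations whose defining formula yields no distribution take a fixed default value. $\mathsf{infer}$ is interpreted by an arbitrary exact inference algorithm $\mathsf{AlgInf}$, i.e. $\mathsf{ran}(\mathsf{AlgInf}\,\mu)=\mu$ for all $\mu$. The statement holds for every $n$ and every such $\mathsf{AlgInf}$. *Divergences.* $\mathcal F$ is the class of $f$ convex on $(0,\infty)$ with $f(1)=0$, and $\Delta_f(\mu,\nu)=\sum_a\nu(a)f(\mu(a)/\nu(a))$, where $f(0)=\lim_{t\to0^+}f(t)$, $0f(0/0)=0$ and $0f(p/0)=p\lim_{u\to\infty}f(u)/u$. $\epsilon\text{-}\mathsf D(x)=\max(x-e^\epsilon,0)$.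 A pair $(f_1,f_2)$ is $f_3$-composable if $f_1,f_2,f_3\in\mathcal F$ and always $\Delta_{f_3}(\mathsf{bind}\,\mu_1M_1,\mathsf{bind}\,\mu_2M_2)\le\Delta_{f_1}(\mu_1,\mu_2)+\sup_v\Delta_{f_2}(M_1v,M_2v)$. Distributions $\mu_1,\mu_2$ are in the $(f,\delta)$-lifting of a relation $\Psi$ if there are distributions $\mu_L,\mu_R$ supported in $\Psi$ such that the first marginal of $\mu_L$ is $\mu_1$, the second marginal of $\mu_R$ is $\mu_2$ and $\Delta_f(\mu_L,\mu_R)\le\delta$. *Relational types and assertions.* A relational variable $x$ has a left and a right instance $x_\triangleleft,x_\triangleright$. Relational types are $\beta$, $\mathfrak D[\beta]$, $\mathfrak M_{f,\delta}T$ ($T$ refining $\beta$ or $\mathfrak D[\beta]$; $f,\delta$ relational expressions), $\Pi(x::T).U$ and $\{x::T\mid\phi\}$. Assertions are built from $\Delta_f(e_1,e_2)\le\delta$, $f\in\mathcal F$, $e_1=e_2$ and $e_1\le e_2$ by propositional connectives and by quantifiers over plain variables $x:\tau$ and relational variables $x::T$. A relational type denotes a relation on the denotation of its underlying simple type: the full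 relation for $\beta$ and $\mathfrak D[\beta]$, the $(f,\delta)$-lifting for $\mathfrak M_{f,\delta}T$, the pairs of functions sending related arguments to related results for $\Pi$, and the restriction by $\phi$ for a refinement. A relational environment $G$ is a sequence of bindings $x::T$ and of assertions (path conditions); $\theta\Vdash G$ means that the valuation $\theta$ of left and right instances satisfies all of them. "Valid under $G$" means true for all $\theta\Vdash G$. *Subtyping* $G\vdash T\preceq U$: reflexivity, transitivity; $\{x::T\mid\phi\}\preceq T$; $T\preceq\{x::U\mid\phi\}$ if $T\preceq U$ and $\phi$ is valid under $G,x::T$; contra- /covariance for $\Pi$; $\mathfrak M_{f_1,\delta_1}T\preceq\mathfrak M_{f_2,\delta_2}U$ if $T\preceq U$, $f_1,f_2\in\mathcal F$ is valid under $G$, and $f_2\le f_1$ pointwise on $(0,\infty)$ and $\delta_1\le\delta_2<\infty$ are valid under $G,x::T$. *Typing* $G\vdash e_1\sim e_2::T$ (the rules relate two expressions with the same head symbol, written here once, unless stated otherwise): variables have the type given by $G$; constants have their simple type; the usual rules for $\lambda$ and for dependent application (substituting the left argument for $x_\triangleleft$ and the right one for $x_\triangleright$); subsumption; $e_1\sim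 e_2::\{x::T\mid\phi\}$ if $e_1\sim e_2::T$ and $\phi$ is valid under $G$ at $(e_1,e_2)$; replacement of either expression by one with the same denotation; $\mathsf{letrec}\,f\,x=e::\Pi(x::T).U$ if, for some measure $m$ from the monad-free argument type to $\mathbb N$, in each of the two bodies the value at $x$ depends only on the values of $f$ at arguments of smaller measure, and the bodies have type $U$ under $G,\ x::T,\ f::\Pi(x'::\{x'::T\mid m(x'_\triangleleft)<m(x_\triangleleft)\wedge m(x'_\triangleright)<m(x_\triangleright)\}).U[x'/x]$; synchronous $\mathsf{case}$ (both scrutinees, of the same basic type, validly have the same head constructor) and asynchronous $\mathsf{case}$ on the left or on the right (against an arbitrary expression), each branch being typed under its path condition; $\mathsf{unit}\,e::\mathfrak M_{f,\delta}T$ if $e::T$ and $f\in\mathcal F$ is valid; $\mathsf{mlet}\,x=e_1\,\mathsf{in}\,e_2::\mathfrak M_{f_3,\delta_1+\delta_2}T_2$ if $e_1::\mathfrak M_{f_1,\delta_1}T_1$, $(f_1,f_2)$ is validly $f_3$-composable and $G,x::T_1\vdash e_2::\mathfrak M_{f_2,\delta_2}T_2$, with $x$ not in $f_2,\delta_2,T_2$;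 $\mathsf{infer}\,e::\{x::\mathfrak D[\beta]\mid\Delta_f(x_\triangleleft,x_\triangleright)\le\delta\}$ if $e::\mathfrak M_{f,\delta}\{x::\beta\mid x_\triangleleft=x_\triangleright\}$, where $\Delta_f$ of symbols is $\Delta_f$ of the distributions they represent, and conversely for $\mathsf{ran}$; $\mathsf{observe}\,x\Rightarrow t\,\mathsf{in}\,u::\mathfrak M_{f,\delta''}\{y::\beta\mid y_\triangleleft=y_\triangleright\}$ if $u::\mathfrak M_{f,\delta}\{y::\beta\mid y_\triangleleft=y_\triangleright\}$, $G,x::\beta\vdash t::\mathfrak M_{f,\delta'}\{y::\mathbb B\mid y_\triangleleft=y_\triangleright\}$ with $x$ not in $f,\delta'$, and the bound $\Delta_f\le\delta''$ between the left and right $\mathsf{observe}$ expressions is valid under $G$; symbolic distributions and $\mathsf{getParams}$ have their simple types; a mechanism $\mathsf{lapMech}$, $\mathsf{gaussMech}$ or $\mathsf{expMech}$ with well-typed arguments has type $\mathfrak M_{f,\delta}\{y\mid y_\triangleleft=y_\triangleright\}$ whenever the bound $\Delta_f\le\delta$ between its left and right instance is valid under $G$. -/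

import Mathlib

open scoped NNReal ENNReal

noncomputable section

namespace PrivInfer

/-! ### Simple types and their interpretation -/

/-- Basic types: unit, booleans, naturals, `ℝ`, `ℝ⁺` (non-negative reals),
extended non-negative reals, the unit interval, lists. -/
inductive BTy : Type where
  | unit | bool | nat | real | preal | epreal | unitI
  | list (b : BTy)

/-- Types over which the probability monad may be formed: basic types and
types of symbolic distributions over a basic type. -/
inductive VTy : Type where
  | base (b : BTy)
  | dist (b : BTy)

/-- Simple types. -/
inductive STy : Type where
  | val (v : VTy)
  | mon (v : VTy)
  | arr (σ τ : STy)

abbrev STy.base (b : BTy) : STy := .val (.base b)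
abbrev STy.dist (b : BTy) : STy := .val (.dist b)

/-- Simple types without the probability monad. -/
def STy.Data : STy → Prop
  | .val _ => True
  | .mon _ => False
  | .arr σ τ => σ.Data ∧ τ.Data

@[reducible] def BTy.Sem : BTy → Type
  | .unit => Unit
  | .bool => Bool
  | .nat => ℕ
  | .real => ℝ
  | .preal => ℝ≥0
  | .epreal => ℝ≥0∞
  | .unitI => unitInterval
  | .list b => List b.Sem

/-- Symbolic distributions: syntactic representations of discrete distributions.  Besides the named
families there is, for every basic type other than the booleans (where Bernoulli already covers
everything), a symbolic table for each discrete distribution. -/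
inductive Sym : BTy → Type where
  | uniform : Sym .unitI
  | bernoulli (p : unitInterval) : Sym .bool
  | normal (m : ℝ) (v : ℝ≥0) : Sym .real
  | beta (a b : ℝ≥0) : Sym .unitI
  | table (b : BTy) (hb : b ≠ .bool) (μ : PMF b.Sem) : Sym b

/-- The parameters of a symbolic distribution. -/
def Sym.params {b : BTy} : Sym b → List ℝ
  | .uniform => []
  | .bernoulli p => [p.1]
  | .normal m v => [m, v]
  | .beta a b => [a, b]
  | .table _ _ _ => []

@[reducible] def VTy.Sem : VTy → Type
  | .base b => b.Sem
  | .dist b => Sym b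

@[reducible] def STy.Sem : STy → Type
  | .val v => v.Sem
  | .mon v => PMF v.Sem
  | .arr σ τ => σ.Sem → τ.Sem

instance BTy.nonempty_sem : (b : BTy) → Nonempty b.Sem
  | .unit => ⟨()⟩
  | .bool => ⟨true⟩
  | .nat => ⟨(0 : ℕ)⟩
  | .real => ⟨(0 : ℝ)⟩
  | .preal => ⟨(0 : ℝ≥0)⟩
  | .epreal => ⟨(0 : ℝ≥0∞)⟩
  | .unitI => ⟨(0 : unitInterval)⟩
  | .list _ => ⟨[]⟩

instance Sym.nonempty (b : BTy) : Nonempty (Sym b) := by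
  by_cases hb : b = .bool
  · subst hb
    exact ⟨.bernoulli 0⟩
  · exact ⟨.table b hb (PMF.pure (Classical.choice (BTy.nonempty_sem b)))⟩

instance VTy.nonempty_sem : (v : VTy) → Nonempty v.Sem
  | .base b => BTy.nonempty_sem b
  | .dist b => Sym.nonempty b

instance STy.nonempty_sem : (τ : STy) → Nonempty τ.Sem
  | .val v => VTy.nonempty_sem v
  | .mon v => ⟨PMF.pure (Classical.choice (VTy.nonempty_sem v))⟩
  | .arr _ τ => ⟨fun _ => Classical.choice (STy.nonempty_sem τ)⟩

/-! ### Discrete distributions -/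

/-- Discrete version of a probability measure on `ℝ` at precision `n`: round down to the grid
`2⁻ⁿ ℤ`.  (The Dirac distribution at `0` if `μ` is not a probability measure.) -/
def discretize (n : ℕ) (μ : MeasureTheory.Measure ℝ) : PMF ℝ :=
  open Classical in
  if h : MeasureTheory.IsProbabilityMeasure (μ.map fun x : ℝ => ⌊x * 2 ^ n⌋) then
    (@MeasureTheory.Measure.toPMF ℤ _ _ _ (μ.map fun x : ℝ => ⌊x * 2 ^ n⌋) h).map
      fun k : ℤ => (k : ℝ) / 2 ^ n
  else PMF.pure 0

/-- The Laplace distribution with location `c` and scale `1 / ε`. -/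
def laplaceMeasure (ε : ℝ≥0) (c : ℝ) : MeasureTheory.Measure ℝ :=
  MeasureTheory.volume.withDensity fun x => ENNReal.ofReal (ε / 2 * Real.exp (-|x - c| * ε))

/-- A function with finite non-zero total mass, rescaled to a distribution; `dflt` otherwise. -/
def rescale {A : Type} (w : A → ℝ≥0∞) (dflt : PMF A) : PMF A :=
  open Classical in
  if h : tsum w ≠ 0 ∧ tsum w ≠ ⊤ then PMF.normalize w h.1 h.2 else dflt

/-- Conditioning `μ` on the event described by the (probabilistic) predicate `t`. -/
def observe {A : Type} (μ : PMF A) (t : A → PMF Bool) : PMF A :=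
  rescale (fun d => μ d * t d true) μ

/-- The exponential mechanism. -/
def expMech {D R : Type} [Nonempty R] (ε : ℝ) (q : D → R → ℝ) (d : D) : PMF R :=
  rescale (fun r => ENNReal.ofReal (Real.exp (q d r * ε / 2)))
    (PMF.pure (Classical.arbitrary R))

/-- The Bernoulli distribution. -/
def bern (p : unitInterval) : PMF Bool :=
  PMF.ofFintype (fun b => cond b (ENNReal.ofReal p) (ENNReal.ofReal (1 - p))) (by
    simp only [Fintype.sum_bool, cond_true, cond_false]
    rw [← ENNReal.ofReal_add p.2.1 (sub_nonneg.2 p.2.2)]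
    simp)

/-- The actual distribution denoted by a symbolic distribution, at precision `n`. -/
def Sym.ran (n : ℕ) {b : BTy} : Sym b → PMF b.Sem
  | .uniform => (discretize n (MeasureTheory.volume.restrict (Set.Icc 0 1))).map
      (Set.projIcc 0 1 zero_le_one)
  | .bernoulli p => bern p
  | .normal m v => discretize n (ProbabilityTheory.gaussianReal m v)
  | .beta a b => (discretize n (ProbabilityTheory.betaMeasure a b)).map
      (Set.projIcc 0 1 zero_le_one)
  | .table _ _ μ => μ

/-- What the semantics leaves open: the precision at which continuous distributions are replaced by
discrete ones, and the (exact, never failing) inference algorithm. -/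
structure Model where
  prec : ℕ
  algInf : {b : BTy} → PMF b.Sem → Sym b
  exact_algInf : ∀ {b : BTy} (μ : PMF b.Sem), (algInf μ).ran prec = μ

/-! ### `f`-divergences, liftings, differential privacy -/

/-- The class of functions defining `f`-divergences; only the values on `x > 0` matter. -/
def ClassF (f : ℝ → ℝ) : Prop := ConvexOn ℝ (Set.Ioi 0) f ∧ f 1 = 0

/-- The summand `q · f (p / q)` for `p, q ≥ 0`, with the usual conventions: `f 0` is the limit of `f`
at `0⁺`, `0 · f (0 / 0) = 0` and `0 · f (p / 0) = p · lim_{u → ∞} f u / u`.  For `f` in `ClassF` both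
limits exist in the extended reals, and `limsup` is the limit. -/
def divTerm (f : ℝ → ℝ) (p q : ℝ) : EReal :=
  open Classical in
  if q = 0 then
    if p = 0 then 0
    else (p : EReal) * Filter.limsup (fun u : ℝ => ((f u / u : ℝ) : EReal)) Filter.atTop
  else if p = 0 then
    (q : EReal) * Filter.limsup (fun u : ℝ => ((f u : ℝ) : EReal)) (nhdsWithin 0 (Set.Ioi 0))
  else ((q * f (p / q) : ℝ) : EReal)

/-- The `f`-divergence, as the sum of the positive parts minus the sum of the negative parts (the
latter sum is finite for `f` in `ClassF`). -/
def fDiv (f : ℝ → ℝ) {A : Type} (μ ν : PMF A) : EReal :=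
  ((∑' a, (divTerm f (μ a).toReal (ν a).toReal).toENNReal : ℝ≥0∞) : EReal) -
    ((∑' a, (-divTerm f (μ a).toReal (ν a).toReal).toENNReal : ℝ≥0∞) : EReal)

/-- The function of the `ε`-distance. -/
def epsDFun (ε : ℝ≥0) (x : ℝ) : ℝ := max (x - Real.exp ε) 0

/-- `(f₁, f₂)` are `f₃`-composable. -/
def Composable (f₁ f₂ f₃ : ℝ → ℝ) : Prop :=
  ClassF f₁ ∧ ClassF f₂ ∧ ClassF f₃ ∧
    ∀ (A B : Type) (μ₁ μ₂ : PMF A) (M₁ M₂ : A → PMF B),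
      fDiv f₃ (μ₁.bind M₁) (μ₂.bind M₂) ≤ fDiv f₁ μ₁ μ₂ + ⨆ v, fDiv f₂ (M₁ v) (M₂ v)

/-- The `(f, δ)`-lifting of a relation. -/
def Lifting (f : ℝ → ℝ) (δ : ℝ≥0∞) {A B : Type} (Ψ : A → B → Prop) (μ₁ : PMF A) (μ₂ : PMF B) :
    Prop :=
  ∃ μL μR : PMF (A × B),
    (∀ a b, μL (a, b) ≠ 0 → Ψ a b) ∧ (∀ a b, μR (a, b) ≠ 0 → Ψ a b) ∧
    μL.map Prod.fst = μ₁ ∧ μR.map Prod.snd = μ₂ ∧ fDiv f μL μR ≤ (δ : EReal)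

/-- `(ε, δ)`-differential privacy of `M` with respect to the adjacency relation `Adj`. -/
def IsDP {D R : Type} (Adj : D → D → Prop) (M : D → PMF R) (ε : ℝ≥0) (δ : ℝ≥0∞) : Prop :=
  ∀ d d', Adj d d' → ∀ S : Set R,
    (M d).toOuterMeasure S ≤ ENNReal.ofReal (Real.exp ε) * (M d').toOuterMeasure S + δ

/-! ### Expressions -/

/-- Typed de Bruijn variables. -/
inductive Var : List STy → STy → Type where
  | z {Γ τ} : Var (τ :: Γ) τ
  | s {Γ σ τ} : Var Γ τ → Var (σ :: Γ) τ

/-- Simply typed expressions.  As constants we take all elements of all monad-free types. -/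
inductive Tm : List STy → STy → Type where
  | var {Γ τ} : Var Γ τ → Tm Γ τ
  | const {Γ} (τ : STy) (h : τ.Data) (c : τ.Sem) : Tm Γ τ
  | app {Γ σ τ} : Tm Γ (.arr σ τ) → Tm Γ σ → Tm Γ τ
  | lam {Γ σ τ} : Tm (σ :: Γ) τ → Tm Γ (.arr σ τ)
  /-- `letrec f x = e`; in `e`, variable `0` is `f` and variable `1` is `x`. -/
  | letrec {Γ σ τ} : Tm (.arr σ τ :: σ :: Γ) τ → Tm Γ (.arr σ τ)
  /-- `case e of true → e₁ | false → e₂` -/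
  | caseBool {Γ τ} : Tm Γ (.base .bool) → Tm Γ τ → Tm Γ τ → Tm Γ τ
  /-- `case e of 0 → e₁ | S n → e₂`; variable `0` of `e₂` is `n`. -/
  | caseNat {Γ τ} : Tm Γ (.base .nat) → Tm Γ τ → Tm (.base .nat :: Γ) τ → Tm Γ τ
  /-- `case e of [] → e₁ | h :: t → e₂`; variable `0` of `e₂` is `t`, variable `1` is `h`. -/
  | caseList {Γ τ b} : Tm Γ (.base (.list b)) → Tm Γ τ →
      Tm (.base (.list b) :: .base b :: Γ) τ → Tm Γ τ
  | unitM {Γ v} : Tm Γ (.val v) → Tm Γ (.mon v)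
  | bindM {Γ v w} : Tm Γ (.mon v) → Tm (.val v :: Γ) (.mon w) → Tm Γ (.mon w)
  /-- `obs t u` is `observe x ⇒ t in u`, with prior `u` and predicate `t`. -/
  | obs {Γ b} : Tm (.base b :: Γ) (.mon (.base .bool)) → Tm Γ (.mon (.base b)) →
      Tm Γ (.mon (.base b))
  | infer {Γ b} : Tm Γ (.mon (.base b)) → Tm Γ (.dist b)
  | ran {Γ b} : Tm Γ (.dist b) → Tm Γ (.mon (.base b))
  | getParams {Γ b} : Tm Γ (.dist b) → Tm Γ (.base (.list .real))
  | uniform {Γ} : Tm Γ (.dist .unitI)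
  | bernoulli {Γ} : Tm Γ (.base .unitI) → Tm Γ (.dist .bool)
  | normal {Γ} : Tm Γ (.base .real) → Tm Γ (.base .preal) → Tm Γ (.dist .real)
  | beta {Γ} : Tm Γ (.base .preal) → Tm Γ (.base .preal) → Tm Γ (.dist .unitI)
  | lapMech {Γ} : Tm Γ (.base .preal) → Tm Γ (.base .real) → Tm Γ (.mon (.base .real))
  | gaussMech {Γ} : Tm Γ (.base .preal) → Tm Γ (.base .real) → Tm Γ (.mon (.base .real))
  | expMech {Γ σ r} : Tm Γ (.base .real) → Tm Γ (.arr σ (.arr (.val r) (.base .real))) →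
      Tm Γ σ → Tm Γ (.mon r)

/-- Environments (valuations). -/
@[reducible] def Env : List STy → Type
  | [] => Unit
  | τ :: Γ => τ.Sem × Env Γ

def Var.den : {Γ : List STy} → {τ : STy} → Var Γ τ → Env Γ → τ.Sem
  | _, _, .z, γ => γ.1
  | _, _, .s x, γ => x.den γ.2

/-- Denotational semantics.  A `letrec` denotes a fixed point (the typing rule for `letrec` ensures
that there is exactly one). -/
def Tm.den (I : Model) : {Γ : List STy} → {τ : STy} → Tm Γ τ → Env Γ → τ.Sem
  | _, _, .var x, γ => x.den γ
  | _, _, .const _ _ c, _ => c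
  | _, _, .app e₁ e₂, γ => e₁.den I γ (e₂.den I γ)
  | _, _, .lam e, γ => fun a => e.den I (a, γ)
  | _, .arr σ τ, .letrec e, γ =>
      Classical.epsilon fun g : σ.Sem → τ.Sem => ∀ a, g a = e.den I (g, a, γ)
  | _, _, .caseBool e e₁ e₂, γ =>
      match e.den I γ with
      | true => e₁.den I γ
      | false => e₂.den I γ
  | _, _, .caseNat e e₁ e₂, γ =>
      match e.den I γ with
      | 0 => e₁.den I γ
      | n + 1 => e₂.den I (n, γ)
  | _, _, .caseList e e₁ e₂, γ =>
      match e.den I γ with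
      | [] => e₁.den I γ
      | h :: t => e₂.den I (t, h, γ)
  | _, _, .unitM e, γ => PMF.pure (e.den I γ)
  | _, _, .bindM e₁ e₂, γ => (e₁.den I γ).bind fun a => e₂.den I (a, γ)
  | _, _, .obs t u, γ => observe (u.den I γ) fun d => t.den I (d, γ)
  | _, _, .infer e, γ => I.algInf (e.den I γ)
  | _, _, .ran e, γ => (e.den I γ).ran I.prec
  | _, _, .getParams e, γ => (e.den I γ).params
  | _, _, .uniform, _ => Sym.uniform
  | _, _, .bernoulli e, γ => Sym.bernoulli (e.den I γ)
  | _, _, .normal e₁ e₂, γ => Sym.normal (e₁.den I γ) (e₂.den I γ)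
  | _, _, .beta e₁ e₂, γ => Sym.beta (e₁.den I γ) (e₂.den I γ)
  | _, _, .lapMech e₁ e₂, γ => discretize I.prec (laplaceMeasure (e₁.den I γ) (e₂.den I γ))
  | _, _, .gaussMech e₁ e₂, γ =>
      discretize I.prec (ProbabilityTheory.gaussianReal (e₂.den I γ) ((e₁.den I γ) ^ 2 : ℝ≥0))
  | _, _, .expMech e₁ e₂ e₃, γ => PrivInfer.expMech (e₁.den I γ) (e₂.den I γ) (e₃.den I γ)

/-! ### Renaming and substitution -/

abbrev Ren (Γ Δ : List STy) := (τ : STy) → Var Γ τ → Var Δ τ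

def Ren.lift {Γ Δ : List STy} {σ : STy} (ρ : Ren Γ Δ) : Ren (σ :: Γ) (σ :: Δ)
  | _, .z => .z
  | _, .s x => .s (ρ _ x)

def Tm.rename : {Γ : List STy} → {τ : STy} → Tm Γ τ → {Δ : List STy} → Ren Γ Δ → Tm Δ τ
  | _, _, .var x, _, ρ => .var (ρ _ x)
  | _, _, .const τ h c, _, _ => .const τ h c
  | _, _, .app e₁ e₂, _, ρ => .app (e₁.rename ρ) (e₂.rename ρ)
  | _, _, .lam e, _, ρ => .lam (e.rename (Ren.lift ρ))
  | _, _, .letrec e, _, ρ => .letrec (e.rename (Ren.lift (Ren.lift ρ)))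
  | _, _, .caseBool e e₁ e₂, _, ρ => .caseBool (e.rename ρ) (e₁.rename ρ) (e₂.rename ρ)
  | _, _, .caseNat e e₁ e₂, _, ρ => .caseNat (e.rename ρ) (e₁.rename ρ) (e₂.rename (Ren.lift ρ))
  | _, _, .caseList e e₁ e₂, _, ρ =>
      .caseList (e.rename ρ) (e₁.rename ρ) (e₂.rename (Ren.lift (Ren.lift ρ)))
  | _, _, .unitM e, _, ρ => .unitM (e.rename ρ)
  | _, _, .bindM e₁ e₂, _, ρ => .bindM (e₁.rename ρ) (e₂.rename (Ren.lift ρ))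
  | _, _, .obs t u, _, ρ => .obs (t.rename (Ren.lift ρ)) (u.rename ρ)
  | _, _, .infer e, _, ρ => .infer (e.rename ρ)
  | _, _, .ran e, _, ρ => .ran (e.rename ρ)
  | _, _, .getParams e, _, ρ => .getParams (e.rename ρ)
  | _, _, .uniform, _, _ => .uniform
  | _, _, .bernoulli e, _, ρ => .bernoulli (e.rename ρ)
  | _, _, .normal e₁ e₂, _, ρ => .normal (e₁.rename ρ) (e₂.rename ρ)
  | _, _, .beta e₁ e₂, _, ρ => .beta (e₁.rename ρ) (e₂.rename ρ)
  | _, _, .lapMech e₁ e₂, _, ρ => .lapMech (e₁.rename ρ) (e₂.rename ρ)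
  | _, _, .gaussMech e₁ e₂, _, ρ => .gaussMech (e₁.rename ρ) (e₂.rename ρ)
  | _, _, .expMech e₁ e₂ e₃, _, ρ => .expMech (e₁.rename ρ) (e₂.rename ρ) (e₃.rename ρ)

/-- Weakening by one variable. -/
def Tm.wk {Γ : List STy} {σ τ : STy} (e : Tm Γ τ) : Tm (σ :: Γ) τ := e.rename fun _ x => .s x

/-- A closed expression, in any context. -/
def Tm.closed {Γ : List STy} {τ : STy} (e : Tm [] τ) : Tm Γ τ := e.rename fun _ x => nomatch x

abbrev Subst (Γ Δ : List STy) := (τ : STy) → Var Γ τ → Tm Δ τ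

def Subst.lift {Γ Δ : List STy} {σ : STy} (s : Subst Γ Δ) : Subst (σ :: Γ) (σ :: Δ)
  | _, .z => .var .z
  | _, .s x => (s _ x).wk

/-- The substitution that adds `e` for variable `0` to `s`. -/
def Subst.cons {Γ Δ : List STy} {σ : STy} (e : Tm Δ σ) (s : Subst Γ Δ) : Subst (σ :: Γ) Δ
  | _, .z => e
  | _, .s x => s _ x

def Tm.subst : {Γ : List STy} → {τ : STy} → Tm Γ τ → {Δ : List STy} → Subst Γ Δ → Tm Δ τ
  | _, _, .var x, _, s => s _ x
  | _, _, .const τ h c, _, _ => .const τ h c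
  | _, _, .app e₁ e₂, _, s => .app (e₁.subst s) (e₂.subst s)
  | _, _, .lam e, _, s => .lam (e.subst (Subst.lift s))
  | _, _, .letrec e, _, s => .letrec (e.subst (Subst.lift (Subst.lift s)))
  | _, _, .caseBool e e₁ e₂, _, s => .caseBool (e.subst s) (e₁.subst s) (e₂.subst s)
  | _, _, .caseNat e e₁ e₂, _, s => .caseNat (e.subst s) (e₁.subst s) (e₂.subst (Subst.lift s))
  | _, _, .caseList e e₁ e₂, _, s =>
      .caseList (e.subst s) (e₁.subst s) (e₂.subst (Subst.lift (Subst.lift s)))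
  | _, _, .unitM e, _, s => .unitM (e.subst s)
  | _, _, .bindM e₁ e₂, _, s => .bindM (e₁.subst s) (e₂.subst (Subst.lift s))
  | _, _, .obs t u, _, s => .obs (t.subst (Subst.lift s)) (u.subst s)
  | _, _, .infer e, _, s => .infer (e.subst s)
  | _, _, .ran e, _, s => .ran (e.subst s)
  | _, _, .getParams e, _, s => .getParams (e.subst s)
  | _, _, .uniform, _, _ => .uniform
  | _, _, .bernoulli e, _, s => .bernoulli (e.subst s)
  | _, _, .normal e₁ e₂, _, s => .normal (e₁.subst s) (e₂.subst s)
  | _, _, .beta e₁ e₂, _, s => .beta (e₁.subst s) (e₂.subst s)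
  | _, _, .lapMech e₁ e₂, _, s => .lapMech (e₁.subst s) (e₂.subst s)
  | _, _, .gaussMech e₁ e₂, _, s => .gaussMech (e₁.subst s) (e₂.subst s)
  | _, _, .expMech e₁ e₂ e₃, _, s => .expMech (e₁.subst s) (e₂.subst s) (e₃.subst s)

/-! ### Some expressions used in types -/

/-- The function `ε-D`, for an expression `ε`. -/
def Tm.epsD {Γ : List STy} (ε : Tm Γ (.base .preal)) : Tm Γ (.arr (.base .real) (.base .real)) :=
  .app (.const (.arr (.base .preal) (.arr (.base .real) (.base .real)))
    ⟨trivial, trivial, trivial⟩ epsDFun) ε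

/-- Addition of extended non-negative reals. -/
def Tm.addE {Γ : List STy} (δ₁ δ₂ : Tm Γ (.base .epreal)) : Tm Γ (.base .epreal) :=
  .app (.app (.const (.arr (.base .epreal) (.arr (.base .epreal) (.base .epreal)))
    ⟨trivial, trivial, trivial⟩ (fun a b : ℝ≥0∞ => a + b)) δ₁) δ₂

def Tm.boolC {Γ : List STy} (c : Bool) : Tm Γ (.base .bool) := .const (.base .bool) trivial c

def Tm.zeroC {Γ : List STy} : Tm Γ (.base .nat) := .const (.base .nat) trivial (0 : ℕ)

def Tm.succC {Γ : List STy} (e : Tm Γ (.base .nat)) : Tm Γ (.base .nat) :=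
  .app (.const (.arr (.base .nat) (.base .nat)) ⟨trivial, trivial⟩ Nat.succ) e

def Tm.nilC {Γ : List STy} {b : BTy} : Tm Γ (.base (.list b)) :=
  .const (.base (.list b)) trivial ([] : List b.Sem)

def Tm.consC {Γ : List STy} {b : BTy} (e₁ : Tm Γ (.base b)) (e₂ : Tm Γ (.base (.list b))) :
    Tm Γ (.base (.list b)) :=
  .app (.app (.const (.arr (.base b) (.arr (.base (.list b)) (.base (.list b))))
    ⟨trivial, trivial, trivial⟩ (fun (h : b.Sem) (t : List b.Sem) => h :: t)) e₁) e₂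

/-- The value of a measure `m` at an expression of a monad-free type. -/
def Tm.meas {Γ : List STy} {σ : STy} (hσ : σ.Data) (m : σ.Sem → ℕ) (e : Tm Γ σ) :
    Tm Γ (.base .nat) :=
  .app (.const (.arr σ (.base .nat)) ⟨hσ, trivial⟩ m) e

/-! ### Relational types and assertions

A relational variable `x : τ` is a pair of variables of type `τ`, its left and right instance.
A binder for a relational variable binds variable `0` (left) and variable `1` (right). -/

/-- Basic types that carry a numerical order. -/
def BTy.Num : BTy → Prop
  | .nat | .real | .preal | .epreal | .unitI => True
  | _ => False

def BTy.le : (b : BTy) → b.Num → b.Sem → b.Sem → Prop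
  | .nat, _ => fun x y : ℕ => x ≤ y
  | .real, _ => fun x y : ℝ => x ≤ y
  | .preal, _ => fun x y : ℝ≥0 => x ≤ y
  | .epreal, _ => fun x y : ℝ≥0∞ => x ≤ y
  | .unitI, _ => fun x y : unitInterval => x ≤ y

mutual

/-- Relational types over a context of plain and (split) relational variables, indexed by their
erasure to a simple type. -/
inductive RTy : List STy → STy → Type where
  /-- a basic type, or the type of symbolic distributions over a basic type -/
  | val {Ξ} (v : VTy) : RTy Ξ (.val v)
  /-- `M_{f,δ} T` -/
  | mon {Ξ v} (f : Tm Ξ (.arr (.base .real) (.base .real))) (δ : Tm Ξ (.base .epreal))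
      (T : RTy Ξ (.val v)) : RTy Ξ (.mon v)
  /-- `Π (x :: T). U` -/
  | pi {Ξ σ τ} (T : RTy Ξ σ) (U : RTy (σ :: σ :: Ξ) τ) : RTy Ξ (.arr σ τ)
  /-- `{x :: T | φ}` -/
  | ref {Ξ τ} (T : RTy Ξ τ) (φ : Asrt (τ :: τ :: Ξ)) : RTy Ξ τ

/-- Relational assertions. -/
inductive Asrt : List STy → Type where
  | allP {Ξ} (τ : STy) (φ : Asrt (τ :: Ξ)) : Asrt Ξ
  | exP {Ξ} (τ : STy) (φ : Asrt (τ :: Ξ)) : Asrt Ξ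
  | allR {Ξ τ} (T : RTy Ξ τ) (φ : Asrt (τ :: τ :: Ξ)) : Asrt Ξ
  | exR {Ξ τ} (T : RTy Ξ τ) (φ : Asrt (τ :: τ :: Ξ)) : Asrt Ξ
  /-- `Δ_f(e₁, e₂) ≤ δ` for symbolic distributions -/
  | divD {Ξ b} (f : Tm Ξ (.arr (.base .real) (.base .real))) (e₁ e₂ : Tm Ξ (.dist b))
      (δ : Tm Ξ (.base .epreal)) : Asrt Ξ
  /-- `Δ_f(e₁, e₂) ≤ δ` for actual distributions -/
  | divM {Ξ v} (f : Tm Ξ (.arr (.base .real) (.base .real))) (e₁ e₂ : Tm Ξ (.mon v))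
      (δ : Tm Ξ (.base .epreal)) : Asrt Ξ
  /-- `f ∈ 𝓕` -/
  | inF {Ξ} (f : Tm Ξ (.arr (.base .real) (.base .real))) : Asrt Ξ
  | eq {Ξ τ} (e₁ e₂ : Tm Ξ τ) : Asrt Ξ
  | le {Ξ b} (hb : BTy.Num b) (e₁ e₂ : Tm Ξ (.base b)) : Asrt Ξ
  | top {Ξ} : Asrt Ξ
  | bot {Ξ} : Asrt Ξ
  | not {Ξ} (φ : Asrt Ξ) : Asrt Ξ
  | or {Ξ} (φ ψ : Asrt Ξ) : Asrt Ξ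
  | and {Ξ} (φ ψ : Asrt Ξ) : Asrt Ξ
  | imp {Ξ} (φ ψ : Asrt Ξ) : Asrt Ξ

end

mutual

def RTy.subst : {Ξ : List STy} → {τ : STy} → RTy Ξ τ → {Θ : List STy} → Subst Ξ Θ → RTy Θ τ
  | _, _, .val v, _, _ => .val v
  | _, _, .mon f δ T, _, s => .mon (f.subst s) (δ.subst s) (T.subst s)
  | _, _, .pi T U, _, s => .pi (T.subst s) (U.subst (Subst.lift (Subst.lift s)))
  | _, _, .ref T φ, _, s => .ref (T.subst s) (φ.subst (Subst.lift (Subst.lift s)))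

def Asrt.subst : {Ξ : List STy} → Asrt Ξ → {Θ : List STy} → Subst Ξ Θ → Asrt Θ
  | _, .allP τ φ, _, s => .allP τ (φ.subst (Subst.lift s))
  | _, .exP τ φ, _, s => .exP τ (φ.subst (Subst.lift s))
  | _, .allR T φ, _, s => .allR (T.subst s) (φ.subst (Subst.lift (Subst.lift s)))
  | _, .exR T φ, _, s => .exR (T.subst s) (φ.subst (Subst.lift (Subst.lift s)))
  | _, .divD f e₁ e₂ δ, _, s => .divD (f.subst s) (e₁.subst s) (e₂.subst s) (δ.subst s)
  | _, .divM f e₁ e₂ δ, _, s => .divM (f.subst s) (e₁.subst s) (e₂.subst s) (δ.subst s)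
  | _, .inF f, _, s => .inF (f.subst s)
  | _, .eq e₁ e₂, _, s => .eq (e₁.subst s) (e₂.subst s)
  | _, .le hb e₁ e₂, _, s => .le hb (e₁.subst s) (e₂.subst s)
  | _, .top, _, _ => .top
  | _, .bot, _, _ => .bot
  | _, .not φ, _, s => .not (φ.subst s)
  | _, .or φ ψ, _, s => .or (φ.subst s) (ψ.subst s)
  | _, .and φ ψ, _, s => .and (φ.subst s) (ψ.subst s)
  | _, .imp φ ψ, _, s => .imp (φ.subst s) (ψ.subst s)

end

mutual

/-- Relational interpretation of types. -/
def RTy.den (I : Model) :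
    {Ξ : List STy} → {τ : STy} → RTy Ξ τ → Env Ξ → τ.Sem → τ.Sem → Prop
  | _, _, .val _, _ => fun _ _ => True
  | _, _, .mon f δ T, θ => fun μ₁ μ₂ => Lifting (f.den I θ) (δ.den I θ) (T.den I θ) μ₁ μ₂
  | _, _, .pi T U, θ => fun g₁ g₂ =>
      ∀ d₁ d₂, T.den I θ d₁ d₂ → U.den I (d₁, d₂, θ) (g₁ d₁) (g₂ d₂)
  | _, _, .ref T φ, θ => fun d₁ d₂ => T.den I θ d₁ d₂ ∧ φ.den I (d₁, d₂, θ)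

/-- Interpretation of assertions. -/
def Asrt.den (I : Model) : {Ξ : List STy} → Asrt Ξ → Env Ξ → Prop
  | _, .allP τ φ, θ => ∀ d : τ.Sem, φ.den I (d, θ)
  | _, .exP τ φ, θ => ∃ d : τ.Sem, φ.den I (d, θ)
  | _, .allR T φ, θ => ∀ d₁ d₂, T.den I θ d₁ d₂ → φ.den I (d₁, d₂, θ)
  | _, .exR T φ, θ => ∃ d₁ d₂, T.den I θ d₁ d₂ ∧ φ.den I (d₁, d₂, θ)
  | _, .divD f e₁ e₂ δ, θ =>
      fDiv (f.den I θ) ((e₁.den I θ).ran I.prec) ((e₂.den I θ).ran I.prec)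
        ≤ ((δ.den I θ : ℝ≥0∞) : EReal)
  | _, .divM f e₁ e₂ δ, θ =>
      fDiv (f.den I θ) (e₁.den I θ) (e₂.den I θ) ≤ ((δ.den I θ : ℝ≥0∞) : EReal)
  | _, .inF f, θ => ClassF (f.den I θ)
  | _, .eq e₁ e₂, θ => e₁.den I θ = e₂.den I θ
  | _, .le (b := b) hb e₁ e₂, θ => b.le hb (e₁.den I θ) (e₂.den I θ)
  | _, .top, _ => True
  | _, .bot, _ => False
  | _, .not φ, θ => ¬ φ.den I θ
  | _, .or φ ψ, θ => φ.den I θ ∨ ψ.den I θ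
  | _, .and φ ψ, θ => φ.den I θ ∧ ψ.den I θ
  | _, .imp φ ψ, θ => φ.den I θ → ψ.den I θ

end

/-- Weakening by one relational variable. -/
def RTy.wk {Ξ : List STy} {σ τ : STy} (T : RTy Ξ τ) : RTy (σ :: σ :: Ξ) τ :=
  T.subst fun _ x => .var (.s (.s x))

/-- Substitution of the left and right instance of the last relational variable. -/
def RTy.inst {Ξ : List STy} {σ τ : STy} (U : RTy (σ :: σ :: Ξ) τ) (e₁ e₂ : Tm Ξ σ) : RTy Ξ τ :=
  U.subst (Subst.cons e₁ (Subst.cons e₂ fun _ x => .var x))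

/-- A monad-free simple type as a relational type (without refinements). -/
def RTy.plain {Ξ : List STy} : (τ : STy) → τ.Data → RTy Ξ τ
  | .val v, _ => .val v
  | .arr σ τ, h => .pi (RTy.plain σ h.1) (RTy.plain τ h.2)

/-- `{x :: T | x◁ = x▷}`, for a basic type or a type of symbolic distributions. -/
def RTy.eqv {Ξ : List STy} (v : VTy) : RTy Ξ (.val v) :=
  .ref (.val v) (.eq (.var .z) (.var (.s .z)))

/-! ### Relational environments -/

/-- The context of left and right instances of the variables of `Γ`. -/
@[reducible] def dbl : List STy → List STy
  | [] => []
  | τ :: Γ => τ :: τ :: dbl Γ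

def Var.left : {Γ : List STy} → {τ : STy} → Var Γ τ → Var (dbl Γ) τ
  | _, _, .z => .z
  | _, _, .s x => .s (.s x.left)

def Var.right : {Γ : List STy} → {τ : STy} → Var Γ τ → Var (dbl Γ) τ
  | _, _, .z => .s .z
  | _, _, .s x => .s (.s x.right)

/-- An expression with every variable replaced by its left (resp. right) instance. -/
def Tm.left {Γ : List STy} {τ : STy} (e : Tm Γ τ) : Tm (dbl Γ) τ := e.rename fun _ x => x.left

def Tm.right {Γ : List STy} {τ : STy} (e : Tm Γ τ) : Tm (dbl Γ) τ := e.rename fun _ x => x.right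

/-- Relational environments.  Besides bindings `x :: T` they may record assertions (the path
conditions of `case`). -/
inductive REnv : List STy → Type where
  | nil : REnv []
  | ext {Γ τ} (G : REnv Γ) (T : RTy (dbl Γ) τ) : REnv (τ :: Γ)
  | asm {Γ} (G : REnv Γ) (φ : Asrt (dbl Γ)) : REnv Γ

def REnv.lookup : {Γ : List STy} → REnv Γ → {τ : STy} → Var Γ τ → RTy (dbl Γ) τ
  | _, .ext _ T, _, .z => T.wk
  | _, .ext G _, _, .s x => (G.lookup x).wk
  | _, .asm G _, _, x => G.lookup x

/-- `θ ⊩ G`. -/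
def REnv.Valid (I : Model) : {Γ : List STy} → REnv Γ → Env (dbl Γ) → Prop
  | _, .nil, _ => True
  | _, .ext G T, θ => G.Valid I θ.2.2 ∧ T.den I θ.2.2 θ.1 θ.2.1
  | _, .asm G φ, θ => G.Valid I θ ∧ φ.den I θ

/-- Validity of an assertion under a relational environment. -/
def Entails (I : Model) {Γ : List STy} (G : REnv Γ) (φ : Asrt (dbl Γ)) : Prop :=
  ∀ θ, G.Valid I θ → φ.den I θ

/-! ### Relational subtyping and typing -/

/-- Relational subtyping `G ⊢ T ⪯ U`.  In the monadic rule the larger type has the smaller divergence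
(as for `ε₁-D` and `ε₂-D` with `ε₁ ≤ ε₂`) and the larger bound. -/
inductive SubTy (I : Model) :
    {Γ : List STy} → REnv Γ → {τ : STy} → RTy (dbl Γ) τ → RTy (dbl Γ) τ → Prop where
  | refl {Γ τ} {G : REnv Γ} (T : RTy (dbl Γ) τ) : SubTy I G T T
  | trans {Γ τ} {G : REnv Γ} {T U V : RTy (dbl Γ) τ} :
      SubTy I G T U → SubTy I G U V → SubTy I G T V
  | left {Γ τ} {G : REnv Γ} (T : RTy (dbl Γ) τ) (φ : Asrt (τ :: τ :: dbl Γ)) :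
      SubTy I G (.ref T φ) T
  | right {Γ τ} {G : REnv Γ} {T U : RTy (dbl Γ) τ} (φ : Asrt (τ :: τ :: dbl Γ)) :
      SubTy I G T U → Entails I (G.ext T) φ → SubTy I G T (.ref U φ)
  | prod {Γ σ τ} {G : REnv Γ} {T₁ T₂ : RTy (dbl Γ) σ} {U₁ U₂ : RTy (σ :: σ :: dbl Γ) τ} :
      SubTy I G T₂ T₁ → SubTy I (G.ext T₂) U₁ U₂ → SubTy I G (.pi T₁ U₁) (.pi T₂ U₂)
  | mon {Γ v} {G : REnv Γ} {T U : RTy (dbl Γ) (.val v)}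
      {f₁ f₂ : Tm (dbl Γ) (.arr (.base .real) (.base .real))} {δ₁ δ₂ : Tm (dbl Γ) (.base .epreal)} :
      SubTy I G T U → Entails I G (.inF f₁) → Entails I G (.inF f₂) →
      (∀ θ d₁ d₂, (G.ext T).Valid I (d₁, d₂, θ) →
        (∀ x : ℝ, 0 < x → f₂.den I θ x ≤ f₁.den I θ x) ∧
          (δ₁.den I θ : ℝ≥0∞) ≤ δ₂.den I θ ∧ (δ₂.den I θ : ℝ≥0∞) < ⊤) →
      SubTy I G (.mon f₁ δ₁ T) (.mon f₂ δ₂ U)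

/-- The termination guard of `letrec`: recursive calls are only made on arguments of smaller
measure. -/
def Guarded (I : Model) {Γ : List STy} {σ τ : STy} (m : σ.Sem → ℕ)
    (e : Tm (.arr σ τ :: σ :: Γ) τ) : Prop :=
  ∀ (γ : Env Γ) (a : σ.Sem) (g h : σ.Sem → τ.Sem), (∀ a', m a' < m a → g a' = h a') →
    e.den I (g, a, γ) = e.den I (h, a, γ)

/-- The type under which recursive calls of `letrec f x = e :: Π (x :: T). U` are made in the scope
of `x`: `Π (x' :: {x' :: T | m x'◁ < m x◁ ∧ m x'▷ < m x▷}). U[x'/x]`. -/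
def RTy.recCall {Ξ : List STy} {σ τ : STy} (hσ : σ.Data) (m : σ.Sem → ℕ) (T : RTy Ξ σ)
    (U : RTy (σ :: σ :: Ξ) τ) : RTy (σ :: σ :: Ξ) (.arr σ τ) :=
  .pi
    (.ref T.wk (.and
      (.le (b := .nat) trivial (.succC (.meas hσ m (.var .z))) (.meas hσ m (.var (.s (.s .z)))))
      (.le (b := .nat) trivial (.succC (.meas hσ m (.var (.s .z))))
        (.meas hσ m (.var (.s (.s (.s .z))))))))
    (U.subst (Subst.cons (.var .z) (Subst.cons (.var (.s .z))
      fun _ x => .var (.s (.s (.s (.s x)))))))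

/-- Environment extension by the variables of a cons pattern: head, then tail. -/
abbrev REnv.extCons {Γ : List STy} (G : REnv Γ) (b : BTy) :
    REnv (.base (.list b) :: .base b :: Γ) :=
  (G.ext (.val (.base b))).ext (.val (.base (.list b)))

/-- Relational typing `G ⊢ e₁ ∼ e₂ :: T`. -/
inductive HasTy (I : Model) :
    {Γ : List STy} → REnv Γ → {τ : STy} → Tm Γ τ → Tm Γ τ → RTy (dbl Γ) τ → Prop where
  | var {Γ τ} {G : REnv Γ} (x : Var Γ τ) : HasTy I G (.var x) (.var x) (G.lookup x)
  | const {Γ} {G : REnv Γ} (τ : STy) (h : τ.Data) (c : τ.Sem) :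
      HasTy I G (.const τ h c) (.const τ h c) (.plain τ h)
  | lam {Γ σ τ} {G : REnv Γ} {e₁ e₂ : Tm (σ :: Γ) τ} {T : RTy (dbl Γ) σ}
      {U : RTy (σ :: σ :: dbl Γ) τ} :
      HasTy I (G.ext T) e₁ e₂ U → HasTy I G (.lam e₁) (.lam e₂) (.pi T U)
  | app {Γ σ τ} {G : REnv Γ} {e₁ e₂ : Tm Γ (.arr σ τ)} {a₁ a₂ : Tm Γ σ} {T : RTy (dbl Γ) σ}
      {U : RTy (σ :: σ :: dbl Γ) τ} :
      HasTy I G e₁ e₂ (.pi T U) → HasTy I G a₁ a₂ T →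
      HasTy I G (.app e₁ a₁) (.app e₂ a₂) (U.inst a₁.left a₂.right)
  | letrec {Γ σ τ} {G : REnv Γ} {e₁ e₂ : Tm (.arr σ τ :: σ :: Γ) τ} {T : RTy (dbl Γ) σ}
      {U : RTy (σ :: σ :: dbl Γ) τ} (hσ : σ.Data) (m : σ.Sem → ℕ) :
      Guarded I m e₁ → Guarded I m e₂ →
      HasTy I ((G.ext T).ext (RTy.recCall hσ m T U)) e₁ e₂ U.wk →
      HasTy I G (.letrec e₁) (.letrec e₂) (.pi T U)
  /-- subsumption -/
  | sub {Γ τ} {G : REnv Γ} {e₁ e₂ : Tm Γ τ} {T U : RTy (dbl Γ) τ} :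
      HasTy I G e₁ e₂ T → SubTy I G T U → HasTy I G e₁ e₂ U
  /-- refinement introduction -/
  | ref {Γ τ} {G : REnv Γ} {e₁ e₂ : Tm Γ τ} {T : RTy (dbl Γ) τ} (φ : Asrt (τ :: τ :: dbl Γ)) :
      HasTy I G e₁ e₂ T →
      (∀ θ, G.Valid I θ → φ.den I (e₁.left.den I θ, e₂.right.den I θ, θ)) →
      HasTy I G e₁ e₂ (.ref T φ)
  /-- conversion (in particular by reduction steps on either side) -/
  | conv {Γ τ} {G : REnv Γ} {e₁ e₂ e₁' e₂' : Tm Γ τ} {T : RTy (dbl Γ) τ} :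
      HasTy I G e₁' e₂' T → (∀ γ, e₁.den I γ = e₁'.den I γ) → (∀ γ, e₂.den I γ = e₂'.den I γ) →
      HasTy I G e₁ e₂ T
  -- synchronous case analysis
  | caseBool {Γ τ} {G : REnv Γ} {e e' : Tm Γ (.base .bool)} {e₁ e₂ e₁' e₂' : Tm Γ τ}
      {T : RTy (dbl Γ) τ} :
      HasTy I G e e' (.val (.base .bool)) →
      (∀ θ, G.Valid I θ → (e.left.den I θ = true ↔ e'.right.den I θ = true)) →
      HasTy I (G.asm (.and (.eq e.left (.boolC true)) (.eq e'.right (.boolC true)))) e₁ e₁' T →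
      HasTy I (G.asm (.and (.eq e.left (.boolC false)) (.eq e'.right (.boolC false)))) e₂ e₂' T →
      HasTy I G (.caseBool e e₁ e₂) (.caseBool e' e₁' e₂') T
  | caseNat {Γ τ} {G : REnv Γ} {e e' : Tm Γ (.base .nat)} {e₁ e₁' : Tm Γ τ}
      {e₂ e₂' : Tm (.base .nat :: Γ) τ} {T : RTy (dbl Γ) τ} :
      HasTy I G e e' (.val (.base .nat)) →
      (∀ θ, G.Valid I θ → (e.left.den I θ = (0 : ℕ) ↔ e'.right.den I θ = (0 : ℕ))) →
      HasTy I (G.asm (.and (.eq e.left .zeroC) (.eq e'.right .zeroC))) e₁ e₁' T →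
      HasTy I ((G.ext (.val (.base .nat))).asm
        (.and (.eq e.wk.left (Tm.succC (.var .z)).left)
          (.eq e'.wk.right (Tm.succC (.var .z)).right))) e₂ e₂' T.wk →
      HasTy I G (.caseNat e e₁ e₂) (.caseNat e' e₁' e₂') T
  | caseList {Γ τ b} {G : REnv Γ} {e e' : Tm Γ (.base (.list b))} {e₁ e₁' : Tm Γ τ}
      {e₂ e₂' : Tm (.base (.list b) :: .base b :: Γ) τ} {T : RTy (dbl Γ) τ} :
      HasTy I G e e' (.val (.base (.list b))) →
      (∀ θ, G.Valid I θ →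
        (e.left.den I θ = ([] : List b.Sem) ↔ e'.right.den I θ = ([] : List b.Sem))) →
      HasTy I (G.asm (.and (.eq e.left .nilC) (.eq e'.right .nilC))) e₁ e₁' T →
      HasTy I ((G.extCons b).asm
        (.and (.eq e.wk.wk.left (Tm.consC (.var (.s .z)) (.var .z)).left)
          (.eq e'.wk.wk.right (Tm.consC (.var (.s .z)) (.var .z)).right))) e₂ e₂' T.wk.wk →
      HasTy I G (.caseList e e₁ e₂) (.caseList e' e₁' e₂') T
  -- asynchronous case analysis, on the left and on the right
  | caseBoolL {Γ τ} {G : REnv Γ} {e : Tm Γ (.base .bool)} {e₁ e₂ e' : Tm Γ τ}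
      {T : RTy (dbl Γ) τ} :
      HasTy I (G.asm (.eq e.left (.boolC true))) e₁ e' T →
      HasTy I (G.asm (.eq e.left (.boolC false))) e₂ e' T →
      HasTy I G (.caseBool e e₁ e₂) e' T
  | caseNatL {Γ τ} {G : REnv Γ} {e : Tm Γ (.base .nat)} {e₁ e' : Tm Γ τ}
      {e₂ : Tm (.base .nat :: Γ) τ} {T : RTy (dbl Γ) τ} :
      HasTy I (G.asm (.eq e.left .zeroC)) e₁ e' T →
      HasTy I ((G.ext (.val (.base .nat))).asm
        (.eq e.wk.left (Tm.succC (.var .z)).left)) e₂ e'.wk T.wk →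
      HasTy I G (.caseNat e e₁ e₂) e' T
  | caseListL {Γ τ b} {G : REnv Γ} {e : Tm Γ (.base (.list b))} {e₁ e' : Tm Γ τ}
      {e₂ : Tm (.base (.list b) :: .base b :: Γ) τ} {T : RTy (dbl Γ) τ} :
      HasTy I (G.asm (.eq e.left .nilC)) e₁ e' T →
      HasTy I ((G.extCons b).asm
        (.eq e.wk.wk.left (Tm.consC (.var (.s .z)) (.var .z)).left)) e₂ e'.wk.wk T.wk.wk →
      HasTy I G (.caseList e e₁ e₂) e' T
  | caseBoolR {Γ τ} {G : REnv Γ} {e : Tm Γ (.base .bool)} {e₁ e₂ e' : Tm Γ τ}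
      {T : RTy (dbl Γ) τ} :
      HasTy I (G.asm (.eq e.right (.boolC true))) e' e₁ T →
      HasTy I (G.asm (.eq e.right (.boolC false))) e' e₂ T →
      HasTy I G e' (.caseBool e e₁ e₂) T
  | caseNatR {Γ τ} {G : REnv Γ} {e : Tm Γ (.base .nat)} {e₁ e' : Tm Γ τ}
      {e₂ : Tm (.base .nat :: Γ) τ} {T : RTy (dbl Γ) τ} :
      HasTy I (G.asm (.eq e.right .zeroC)) e' e₁ T →
      HasTy I ((G.ext (.val (.base .nat))).asm
        (.eq e.wk.right (Tm.succC (.var .z)).right)) e'.wk e₂ T.wk →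
      HasTy I G e' (.caseNat e e₁ e₂) T
  | caseListR {Γ τ b} {G : REnv Γ} {e : Tm Γ (.base (.list b))} {e₁ e' : Tm Γ τ}
      {e₂ : Tm (.base (.list b) :: .base b :: Γ) τ} {T : RTy (dbl Γ) τ} :
      HasTy I (G.asm (.eq e.right .nilC)) e' e₁ T →
      HasTy I ((G.extCons b).asm
        (.eq e.wk.wk.right (Tm.consC (.var (.s .z)) (.var .z)).right)) e'.wk.wk e₂ T.wk.wk →
      HasTy I G e' (.caseList e e₁ e₂) T
  -- probabilities
  | unitM {Γ v} {G : REnv Γ} {e₁ e₂ : Tm Γ (.val v)} {T : RTy (dbl Γ) (.val v)}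
      {f : Tm (dbl Γ) (.arr (.base .real) (.base .real))} (δ : Tm (dbl Γ) (.base .epreal)) :
      Entails I G (.inF f) → HasTy I G e₁ e₂ T →
      HasTy I G (.unitM e₁) (.unitM e₂) (.mon f δ T)
  | bindM {Γ v w} {G : REnv Γ} {e₁ e₁' : Tm Γ (.mon v)} {e₂ e₂' : Tm (.val v :: Γ) (.mon w)}
      {T₁ : RTy (dbl Γ) (.val v)} {T₂ : RTy (dbl Γ) (.val w)}
      {f₁ f₂ f₃ : Tm (dbl Γ) (.arr (.base .real) (.base .real))}
      {δ₁ δ₂ : Tm (dbl Γ) (.base .epreal)} :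
      HasTy I G e₁ e₁' (.mon f₁ δ₁ T₁) →
      (∀ θ, G.Valid I θ → Composable (f₁.den I θ) (f₂.den I θ) (f₃.den I θ)) →
      HasTy I (G.ext T₁) e₂ e₂' (RTy.mon f₂ δ₂ T₂).wk →
      HasTy I G (.bindM e₁ e₂) (.bindM e₁' e₂') (.mon f₃ (.addE δ₁ δ₂) T₂)
  | infer {Γ b} {G : REnv Γ} {e₁ e₂ : Tm Γ (.mon (.base b))}
      {f : Tm (dbl Γ) (.arr (.base .real) (.base .real))} {δ : Tm (dbl Γ) (.base .epreal)} :
      HasTy I G e₁ e₂ (.mon f δ (.eqv (.base b))) →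
      HasTy I G (.infer e₁) (.infer e₂)
        (.ref (.val (.dist b)) (.divD f.wk.wk (.var .z) (.var (.s .z)) δ.wk.wk))
  | ran {Γ b} {G : REnv Γ} {e₁ e₂ : Tm Γ (.dist b)}
      {f : Tm (dbl Γ) (.arr (.base .real) (.base .real))} {δ : Tm (dbl Γ) (.base .epreal)} :
      HasTy I G e₁ e₂
        (.ref (.val (.dist b)) (.divD f.wk.wk (.var .z) (.var (.s .z)) δ.wk.wk)) →
      HasTy I G (.ran e₁) (.ran e₂) (.mon f δ (.eqv (.base b)))
  | observe {Γ b} {G : REnv Γ} {u u' : Tm Γ (.mon (.base b))}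
      {t t' : Tm (.base b :: Γ) (.mon (.base .bool))}
      {f : Tm (dbl Γ) (.arr (.base .real) (.base .real))} {δ δ' δ'' : Tm (dbl Γ) (.base .epreal)} :
      HasTy I G u u' (.mon f δ (.eqv (.base b))) →
      HasTy I (G.ext (.val (.base b))) t t' (RTy.mon f δ' (.eqv (.base .bool))).wk →
      Entails I G (.divM f (Tm.obs t u).left (Tm.obs t' u').right δ'') →
      HasTy I G (.obs t u) (.obs t' u') (.mon f δ'' (.eqv (.base b)))
  -- symbolic distributions
  | uniform {Γ} {G : REnv Γ} : HasTy I G .uniform .uniform (.val (.dist .unitI))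
  | bernoulli {Γ} {G : REnv Γ} {e e' : Tm Γ (.base .unitI)} :
      HasTy I G e e' (.val (.base .unitI)) →
      HasTy I G (.bernoulli e) (.bernoulli e') (.val (.dist .bool))
  | normal {Γ} {G : REnv Γ} {e₁ e₁' : Tm Γ (.base .real)} {e₂ e₂' : Tm Γ (.base .preal)} :
      HasTy I G e₁ e₁' (.val (.base .real)) → HasTy I G e₂ e₂' (.val (.base .preal)) →
      HasTy I G (.normal e₁ e₂) (.normal e₁' e₂') (.val (.dist .real))
  | beta {Γ} {G : REnv Γ} {e₁ e₁' e₂ e₂' : Tm Γ (.base .preal)} :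
      HasTy I G e₁ e₁' (.val (.base .preal)) → HasTy I G e₂ e₂' (.val (.base .preal)) →
      HasTy I G (.beta e₁ e₂) (.beta e₁' e₂') (.val (.dist .unitI))
  | getParams {Γ b} {G : REnv Γ} {e e' : Tm Γ (.dist b)} :
      HasTy I G e e' (.val (.dist b)) →
      HasTy I G (.getParams e) (.getParams e') (.val (.base (.list .real)))
  -- private mechanisms: typed with any divergence bound that they satisfy
  | lapMech {Γ} {G : REnv Γ} {e₁ e₁' : Tm Γ (.base .preal)} {e₂ e₂' : Tm Γ (.base .real)}
      {f : Tm (dbl Γ) (.arr (.base .real) (.base .real))} {δ : Tm (dbl Γ) (.base .epreal)} :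
      HasTy I G e₁ e₁' (.val (.base .preal)) → HasTy I G e₂ e₂' (.val (.base .real)) →
      Entails I G (.divM f (Tm.lapMech e₁ e₂).left (Tm.lapMech e₁' e₂').right δ) →
      HasTy I G (.lapMech e₁ e₂) (.lapMech e₁' e₂') (.mon f δ (.eqv (.base .real)))
  | gaussMech {Γ} {G : REnv Γ} {e₁ e₁' : Tm Γ (.base .preal)} {e₂ e₂' : Tm Γ (.base .real)}
      {f : Tm (dbl Γ) (.arr (.base .real) (.base .real))} {δ : Tm (dbl Γ) (.base .epreal)} :
      HasTy I G e₁ e₁' (.val (.base .preal)) → HasTy I G e₂ e₂' (.val (.base .real)) →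
      Entails I G (.divM f (Tm.gaussMech e₁ e₂).left (Tm.gaussMech e₁' e₂').right δ) →
      HasTy I G (.gaussMech e₁ e₂) (.gaussMech e₁' e₂') (.mon f δ (.eqv (.base .real)))
  | expMech {Γ σ r} {G : REnv Γ} {e₁ e₁' : Tm Γ (.base .real)}
      {e₂ e₂' : Tm Γ (.arr σ (.arr (.val r) (.base .real)))} {e₃ e₃' : Tm Γ σ}
      {T₂ : RTy (dbl Γ) (.arr σ (.arr (.val r) (.base .real)))} {T₃ : RTy (dbl Γ) σ}
      {f : Tm (dbl Γ) (.arr (.base .real) (.base .real))} {δ : Tm (dbl Γ) (.base .epreal)} :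
      HasTy I G e₁ e₁' (.val (.base .real)) → HasTy I G e₂ e₂' T₂ → HasTy I G e₃ e₃' T₃ →
      Entails I G (.divM f (Tm.expMech e₁ e₂ e₃).left (Tm.expMech e₁' e₂' e₃').right δ) →
      HasTy I G (.expMech e₁ e₂ e₃) (.expMech e₁' e₂' e₃') (.mon f δ (.eqv r))

end PrivInfer

end

/-!
The type system is sound for the relational semantics: if `G ⊢ e₁ ∼ e₂ :: T` is derivable and `θ`
satisfies `G`, then the left denotation of `e₁` and the right denotation of `e₂` are related by the
denotation of `T` (`HasTy.sound`, by induction on the derivation).  Applied to the hypothesis, it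
relates the two output distributions on adjacent inputs by the `(ε-D, δ)`-lifting of equality.
Witnesses of a lifting of equality are supported on the diagonal, where they are copies of the given
distributions, so such a lifting is exactly a bound on the divergence (`lifting_eq_iff`), and a bound
on the `ε`-distance is `(ε, δ)`-differential privacy (`toOuterMeasure_le_of_fDiv_epsDFun_le`).

Soundness rests on three facts.  Substitution in expressions, types and assertions is composition of
valuations (`Tm.den_subst`, `RTy.den_subst`, `Asrt.den_subst`).  A `letrec` that satisfies the
termination guard denotes a genuine fixed point (`Tm.den_letrec`), about which one argues by
induction on the measure.  Liftings are closed under the operations of the monad: `Lifting.pure`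
because `f 1 = 0` makes the divergence of a distribution from itself vanish, `Lifting.bind` by the
definition of composability, and `Lifting.mono` for subtyping.  The bind and subtyping cases also use
that related values exist whenever a lifting is inhabited (`Lifting.exists_rel`).
-/

namespace PrivInfer

/-! ### Renaming and substitution in the semantics -/

/-- A fixed point exists as soon as the value at `a` depends only on values at arguments of smaller
measure. -/
theorem exists_fixedPoint_of_measure {A B : Type} [Nonempty B] (m : A → ℕ)
    (F : (A → B) → A → B)
    (hF : ∀ a g h, (∀ a', m a' < m a → g a' = h a') → F g a = F h a) :
    ∃ g : A → B, ∀ a, g a = F g a := by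
  classical
  let r : (a : A) → ((a' : A) → m a' < m a → B) → B := fun a rec =>
    F (fun a' => if h : m a' < m a then rec a' h else Classical.arbitrary B) a
  refine ⟨(measure m).wf.fix r, fun a => ?_⟩
  rw [WellFounded.fix_eq]
  exact hF a _ _ fun a' h => dif_pos h

theorem Ren.den_lift {Γ Δ : List STy} {σ : STy} {ρ : Ren Γ Δ} {γ : Env Γ} {δ : Env Δ}
    (h : ∀ τ x, (ρ τ x).den δ = x.den γ) (a : σ.Sem) :
    ∀ τ x, ((Ren.lift ρ : Ren (σ :: Γ) (σ :: Δ)) τ x).den (a, δ) = x.den (a, γ)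
  | _, .z => rfl
  | _, .s x => h _ x

theorem Tm.den_rename (I : Model) {Γ : List STy} {τ : STy} (e : Tm Γ τ) {Δ : List STy}
    {ρ : Ren Γ Δ} {γ : Env Γ} {δ : Env Δ} (h : ∀ τ x, (ρ τ x).den δ = x.den γ) :
    (e.rename ρ).den I δ = e.den I γ := by
  induction e generalizing Δ with
  | var x => exact h _ x
  | const | uniform => rfl
  | lam e ih => exact funext fun a => ih (Ren.den_lift h a)
  | letrec e ih =>
    simp only [Tm.rename, Tm.den]
    congr! 4 with g a
    exact ih (Ren.den_lift (σ := .arr _ _) (Ren.den_lift h a) g)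
  | caseNat e e₁ e₂ ih ih₁ ih₂ =>
    simp only [Tm.rename, Tm.den, ih h, ih₁ h]
    split
    · rfl
    · exact ih₂ (Ren.den_lift h _)
  | caseList e e₁ e₂ ih ih₁ ih₂ =>
    simp only [Tm.rename, Tm.den, ih h, ih₁ h]
    split
    · rfl
    · exact ih₂ (Ren.den_lift (Ren.den_lift h _) _)
  | bindM e₁ e₂ ih₁ ih₂ =>
    simp only [Tm.rename, Tm.den, ih₁ h, ih₂ (Ren.den_lift h _)]
  | obs t u iht ihu =>
    simp only [Tm.rename, Tm.den, ihu h, iht (Ren.den_lift h _)]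
  | unitM _ ih | infer _ ih | ran _ ih | getParams _ ih | bernoulli _ ih =>
    simp only [Tm.rename, Tm.den, ih h]
  | app _ _ ih₁ ih₂ | normal _ _ ih₁ ih₂ | beta _ _ ih₁ ih₂ | lapMech _ _ ih₁ ih₂
  | gaussMech _ _ ih₁ ih₂ =>
    simp only [Tm.rename, Tm.den, ih₁ h, ih₂ h]
  | caseBool _ _ _ ih₁ ih₂ ih₃ | expMech _ _ _ ih₁ ih₂ ih₃ =>
    simp only [Tm.rename, Tm.den, ih₁ h, ih₂ h, ih₃ h]

theorem Tm.den_wk (I : Model) {Γ : List STy} {σ τ : STy} (e : Tm Γ τ) (a : σ.Sem) (γ : Env Γ) :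
    (e.wk (σ := σ)).den I (a, γ) = e.den I γ :=
  e.den_rename I fun _ _ => rfl

theorem Tm.den_wk_wk (I : Model) {Γ : List STy} {σ σ' τ : STy} (e : Tm Γ τ) (a : σ.Sem)
    (a' : σ'.Sem) (γ : Env Γ) : ((e.wk (σ := σ')).wk (σ := σ)).den I (a, a', γ) = e.den I γ :=
  ((e.wk (σ := σ')).den_wk I a (a', γ)).trans (e.den_wk I a' γ)

theorem Tm.den_closed (I : Model) {Γ : List STy} {τ : STy} (e : Tm [] τ) (γ : Env Γ) :
    (e.closed (Γ := Γ)).den I γ = e.den I () :=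
  e.den_rename I fun _ x => nomatch x

theorem Subst.den_lift (I : Model) {Γ Δ : List STy} {σ : STy} {s : Subst Γ Δ} {γ : Env Γ}
    {δ : Env Δ} (h : ∀ τ x, (s τ x).den I δ = x.den γ) (a : σ.Sem) :
    ∀ τ x, ((Subst.lift s : Subst (σ :: Γ) (σ :: Δ)) τ x).den I (a, δ) = x.den (a, γ)
  | _, .z => rfl
  | _, .s x => ((s _ x).den_wk I a δ).trans (h _ x)

theorem Subst.den_cons (I : Model) {Γ Δ : List STy} {σ : STy} {s : Subst Γ Δ} {γ : Env Γ}
    {δ : Env Δ} (h : ∀ τ x, (s τ x).den I δ = x.den γ) (e : Tm Δ σ) :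
    ∀ τ x, (Subst.cons e s τ x).den I δ = x.den (e.den I δ, γ)
  | _, .z => rfl
  | _, .s x => h _ x

theorem Tm.den_subst (I : Model) {Γ : List STy} {τ : STy} (e : Tm Γ τ) {Δ : List STy}
    {s : Subst Γ Δ} {γ : Env Γ} {δ : Env Δ} (h : ∀ τ x, (s τ x).den I δ = x.den γ) :
    (e.subst s).den I δ = e.den I γ := by
  induction e generalizing Δ with
  | var x => exact h _ x
  | const | uniform => rfl
  | lam e ih => exact funext fun a => ih (Subst.den_lift I h a)
  | letrec e ih =>
    simp only [Tm.subst, Tm.den]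
    congr! 4 with g a
    exact ih (Subst.den_lift (σ := .arr _ _) I (Subst.den_lift I h a) g)
  | caseNat e e₁ e₂ ih ih₁ ih₂ =>
    simp only [Tm.subst, Tm.den, ih h, ih₁ h]
    split
    · rfl
    · exact ih₂ (Subst.den_lift I h _)
  | caseList e e₁ e₂ ih ih₁ ih₂ =>
    simp only [Tm.subst, Tm.den, ih h, ih₁ h]
    split
    · rfl
    · exact ih₂ (Subst.den_lift I (Subst.den_lift I h _) _)
  | bindM e₁ e₂ ih₁ ih₂ =>
    simp only [Tm.subst, Tm.den, ih₁ h, ih₂ (Subst.den_lift I h _)]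
  | obs t u iht ihu =>
    simp only [Tm.subst, Tm.den, ihu h, iht (Subst.den_lift I h _)]
  | unitM _ ih | infer _ ih | ran _ ih | getParams _ ih | bernoulli _ ih =>
    simp only [Tm.subst, Tm.den, ih h]
  | app _ _ ih₁ ih₂ | normal _ _ ih₁ ih₂ | beta _ _ ih₁ ih₂ | lapMech _ _ ih₁ ih₂
  | gaussMech _ _ ih₁ ih₂ =>
    simp only [Tm.subst, Tm.den, ih₁ h, ih₂ h]
  | caseBool _ _ _ ih₁ ih₂ ih₃ | expMech _ _ _ ih₁ ih₂ ih₃ =>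
    simp only [Tm.subst, Tm.den, ih₁ h, ih₂ h, ih₃ h]

mutual

theorem RTy.den_subst (I : Model) : {Ξ : List STy} → {τ : STy} → (T : RTy Ξ τ) →
    {Θ : List STy} → {s : Subst Ξ Θ} → {γ : Env Ξ} → {θ : Env Θ} →
    (∀ τ x, (s τ x).den I θ = x.den γ) → (T.subst s).den I θ = T.den I γ
  | _, _, .val _, _, _, _, _, _ => by simp only [RTy.subst, RTy.den]
  | _, _, .mon f δ T, _, _, _, _, h => by
    simp only [RTy.subst, RTy.den, f.den_subst I h, δ.den_subst I h, T.den_subst I h]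
  | _, _, .pi T U, _, _, _, _, h => by
    simp only [RTy.subst, RTy.den, T.den_subst I h,
      U.den_subst I (Subst.den_lift I (Subst.den_lift I h _) _)]
  | _, _, .ref T φ, _, _, _, _, h => by
    simp only [RTy.subst, RTy.den, T.den_subst I h,
      φ.den_subst I (Subst.den_lift I (Subst.den_lift I h _) _)]

theorem Asrt.den_subst (I : Model) : {Ξ : List STy} → (φ : Asrt Ξ) →
    {Θ : List STy} → {s : Subst Ξ Θ} → {γ : Env Ξ} → {θ : Env Θ} →
    (∀ τ x, (s τ x).den I θ = x.den γ) → ((φ.subst s).den I θ ↔ φ.den I γ)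
  | _, .allP _ φ, _, _, _, _, h => by
    simp only [Asrt.subst, Asrt.den, φ.den_subst I (Subst.den_lift I h _)]
  | _, .exP _ φ, _, _, _, _, h => by
    simp only [Asrt.subst, Asrt.den, φ.den_subst I (Subst.den_lift I h _)]
  | _, .allR T φ, _, _, _, _, h => by
    simp only [Asrt.subst, Asrt.den, T.den_subst I h,
      φ.den_subst I (Subst.den_lift I (Subst.den_lift I h _) _)]
  | _, .exR T φ, _, _, _, _, h => by
    simp only [Asrt.subst, Asrt.den, T.den_subst I h,
      φ.den_subst I (Subst.den_lift I (Subst.den_lift I h _) _)]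
  | _, .divD f e₁ e₂ δ, _, _, _, _, h => by
    simp only [Asrt.subst, Asrt.den, f.den_subst I h, e₁.den_subst I h, e₂.den_subst I h,
      δ.den_subst I h]
  | _, .divM f e₁ e₂ δ, _, _, _, _, h => by
    simp only [Asrt.subst, Asrt.den, f.den_subst I h, e₁.den_subst I h, e₂.den_subst I h,
      δ.den_subst I h]
  | _, .inF f, _, _, _, _, h => by simp only [Asrt.subst, Asrt.den, f.den_subst I h]
  | _, .eq e₁ e₂, _, _, _, _, h => by
    simp only [Asrt.subst, Asrt.den, e₁.den_subst I h, e₂.den_subst I h]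
  | _, .le _ e₁ e₂, _, _, _, _, h => by
    simp only [Asrt.subst, Asrt.den, e₁.den_subst I h, e₂.den_subst I h]
  | _, .top, _, _, _, _, _ => by simp only [Asrt.subst, Asrt.den]
  | _, .bot, _, _, _, _, _ => by simp only [Asrt.subst, Asrt.den]
  | _, .not φ, _, _, _, _, h => by simp only [Asrt.subst, Asrt.den, φ.den_subst I h]
  | _, .or φ ψ, _, _, _, _, h => by
    simp only [Asrt.subst, Asrt.den, φ.den_subst I h, ψ.den_subst I h]
  | _, .and φ ψ, _, _, _, _, h => by
    simp only [Asrt.subst, Asrt.den, φ.den_subst I h, ψ.den_subst I h]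
  | _, .imp φ ψ, _, _, _, _, h => by
    simp only [Asrt.subst, Asrt.den, φ.den_subst I h, ψ.den_subst I h]

end

theorem RTy.den_wk (I : Model) {Ξ : List STy} {σ τ : STy} (T : RTy Ξ τ) (a b : σ.Sem)
    (θ : Env Ξ) : (T.wk (σ := σ)).den I (a, b, θ) = T.den I θ :=
  T.den_subst I fun _ _ => rfl

theorem RTy.den_inst (I : Model) {Ξ : List STy} {σ τ : STy} (U : RTy (σ :: σ :: Ξ) τ)
    (e₁ e₂ : Tm Ξ σ) (θ : Env Ξ) :
    (U.inst e₁ e₂).den I θ = U.den I (e₁.den I θ, e₂.den I θ, θ) :=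
  U.den_subst I (Subst.den_cons I (Subst.den_cons I (fun _ _ => rfl) e₂) e₁)

/-- A type without refinements denotes the full relation. -/
theorem RTy.den_plain (I : Model) {Ξ : List STy} : (τ : STy) → (h : τ.Data) → (θ : Env Ξ) →
    (d₁ d₂ : τ.Sem) → (RTy.plain τ h : RTy Ξ τ).den I θ d₁ d₂
  | .val _, _, _, _, _ => by simp only [RTy.plain, RTy.den]
  | .arr _ τ, h, _, _, _ => by
    simp only [RTy.plain, RTy.den]
    exact fun _ _ _ => RTy.den_plain I τ h.2 _ _ _

theorem RTy.den_eqv (I : Model) {Ξ : List STy} (v : VTy) (θ : Env Ξ) :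
    (RTy.eqv v : RTy Ξ (.val v)).den I θ = Eq := by
  funext a b
  simp [RTy.eqv, RTy.den, Asrt.den, Tm.den, Var.den]

/-! ### Left and right instances of a valuation -/

/-- The values of the left instances. -/
def Env.left : {Γ : List STy} → Env (dbl Γ) → Env Γ
  | [], _ => ()
  | _ :: _, θ => (θ.1, Env.left θ.2.2)

/-- The values of the right instances. -/
def Env.right : {Γ : List STy} → Env (dbl Γ) → Env Γ
  | [], _ => ()
  | _ :: _, θ => (θ.2.1, Env.right θ.2.2)

theorem Var.den_left : {Γ : List STy} → {τ : STy} → (x : Var Γ τ) → (θ : Env (dbl Γ)) →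
    x.left.den θ = x.den (Env.left θ)
  | _, _, .z, _ => rfl
  | _, _, .s x, θ => x.den_left θ.2.2

theorem Var.den_right : {Γ : List STy} → {τ : STy} → (x : Var Γ τ) → (θ : Env (dbl Γ)) →
    x.right.den θ = x.den (Env.right θ)
  | _, _, .z, _ => rfl
  | _, _, .s x, θ => x.den_right θ.2.2

theorem Tm.den_left (I : Model) {Γ : List STy} {τ : STy} (e : Tm Γ τ) (θ : Env (dbl Γ)) :
    e.left.den I θ = e.den I (Env.left θ) :=
  e.den_rename I fun _ x => x.den_left θ

theorem Tm.den_right (I : Model) {Γ : List STy} {τ : STy} (e : Tm Γ τ) (θ : Env (dbl Γ)) :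
    e.right.den I θ = e.den I (Env.right θ) :=
  e.den_rename I fun _ x => x.den_right θ

/-- Bound variables of a valuation satisfy the types that the environment gives them. -/
theorem REnv.den_lookup (I : Model) {Γ : List STy} (G : REnv Γ) {τ : STy} (x : Var Γ τ)
    (θ : Env (dbl Γ)) (h : G.Valid I θ) :
    (G.lookup x).den I θ (x.den (Env.left θ)) (x.den (Env.right θ)) := by
  induction G with
  | nil => cases x
  | ext G T ih =>
    obtain ⟨d₁, d₂, θ⟩ := θ
    simp only [REnv.Valid] at h
    cases x with
    | z => exact (iff_of_eq (congrFun₂ (T.den_wk I d₁ d₂ θ) d₁ d₂)).2 h.2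
    | s x => exact (iff_of_eq (congrFun₂ ((G.lookup x).den_wk I d₁ d₂ θ) _ _)).2 (ih x θ h.1)
  | asm G φ ih =>
    simp only [REnv.Valid] at h
    simpa only [REnv.lookup] using ih x θ h.1

/-! ### Divergences -/

theorem divTerm_self {f : ℝ → ℝ} (hf : ClassF f) (p : ℝ) : divTerm f p p = 0 := by
  by_cases hp : p = 0
  · simp [divTerm, hp]
  · simp [divTerm, hp, hf.2]

theorem fDiv_self {f : ℝ → ℝ} (hf : ClassF f) {A : Type} (μ : PMF A) : fDiv f μ μ = 0 := by
  simp [fDiv, divTerm_self hf]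

theorem divTerm_mono {f g : ℝ → ℝ} (h : ∀ x, 0 < x → f x ≤ g x) {p q : ℝ} (hp : 0 ≤ p)
    (hq : 0 ≤ q) : divTerm f p q ≤ divTerm g p q := by
  unfold divTerm
  split_ifs with hq0 hp0 hp0
  · exact le_rfl
  · refine mul_le_mul_of_nonneg_left (Filter.limsup_le_limsup ?_) (EReal.coe_nonneg.2 hp)
    filter_upwards [Filter.eventually_gt_atTop 0] with u hu
    exact EReal.coe_le_coe_iff.2 (div_le_div_of_nonneg_right (h u hu) hu.le)
  · refine mul_le_mul_of_nonneg_left (Filter.limsup_le_limsup ?_) (EReal.coe_nonneg.2 hq)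
    filter_upwards [self_mem_nhdsWithin] with u hu
    exact EReal.coe_le_coe_iff.2 (h u hu)
  · have hp' := lt_of_le_of_ne hp (Ne.symm hp0)
    have hq' := lt_of_le_of_ne hq (Ne.symm hq0)
    exact EReal.coe_le_coe_iff.2 (mul_le_mul_of_nonneg_left (h _ (div_pos hp' hq')) hq)

theorem fDiv_mono {f g : ℝ → ℝ} (h : ∀ x, 0 < x → f x ≤ g x) {A : Type} (μ ν : PMF A) :
    fDiv f μ ν ≤ fDiv g μ ν := by
  have key (a : A) := divTerm_mono h (p := (μ a).toReal) (q := (ν a).toReal)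
    ENNReal.toReal_nonneg ENNReal.toReal_nonneg
  refine EReal.sub_le_sub ?_ ?_
  · exact EReal.coe_ennreal_le_coe_ennreal_iff.2
      (ENNReal.tsum_le_tsum fun a => EReal.toENNReal_le_toENNReal (key a))
  · exact EReal.coe_ennreal_le_coe_ennreal_iff.2
      (ENNReal.tsum_le_tsum fun a => EReal.toENNReal_le_toENNReal (EReal.neg_le_neg_iff.2 (key a)))

theorem fDiv_map_injective (f : ℝ → ℝ) {A B : Type} {i : A → B} (hi : Function.Injective i)
    (μ ν : PMF A) : fDiv f (μ.map i) (ν.map i) = fDiv f μ ν := by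
  have h_apply (ρ : PMF A) (a : A) : (ρ.map i) (i a) = ρ a := by
    classical
    simp [PMF.map_apply, hi.eq_iff]
  have h_zero (ρ : PMF A) (b : B) (hb : b ∉ Set.range i) : (ρ.map i) b = 0 := by
    classical
    rw [PMF.map_apply]
    exact ENNReal.tsum_eq_zero.2 fun a => if_neg fun h => hb ⟨a, h.symm⟩
  have h_tsum (t : EReal → ℝ≥0∞) (ht : t 0 = 0) :
      ∑' b, t (divTerm f ((μ.map i) b).toReal ((ν.map i) b).toReal) =
        ∑' a, t (divTerm f (μ a).toReal (ν a).toReal) := by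
    rw [← hi.tsum_eq fun b hb => ?_]
    · simp only [h_apply]
    · by_contra hr
      exact hb (by simp [h_zero _ b hr, divTerm, ht])
  unfold fDiv
  rw [h_tsum EReal.toENNReal (by simp), h_tsum (fun x => (-x).toENNReal) (by simp)]

theorem divTerm_nonneg {f : ℝ → ℝ} (hf : ∀ x, 0 ≤ f x) {p q : ℝ} (hp : 0 ≤ p) (hq : 0 ≤ q) :
    0 ≤ divTerm f p q := by
  unfold divTerm
  split_ifs
  · exact le_rfl
  · refine mul_nonneg (EReal.coe_nonneg.2 hp) (Filter.le_limsup_of_frequently_le ?_)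
    refine Filter.Eventually.frequently ?_
    filter_upwards [Filter.eventually_gt_atTop 0] with u hu
    exact EReal.coe_nonneg.2 (div_nonneg (hf u) hu.le)
  · exact mul_nonneg (EReal.coe_nonneg.2 hq) (Filter.le_limsup_of_frequently_le
      (Filter.Frequently.of_forall fun u => EReal.coe_nonneg.2 (hf u)))
  · exact EReal.coe_nonneg.2 (mul_nonneg hq (hf _))

theorem epsDFun_nonneg (ε : ℝ≥0) (x : ℝ) : 0 ≤ epsDFun ε x := le_max_right _ _

/-- The recession slope of the `ε`-distance is `1`: mass of the first distribution outside the
support of the second one is counted fully. -/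
theorem limsup_epsDFun_div (ε : ℝ≥0) :
    Filter.limsup (fun u : ℝ => ((epsDFun ε u / u : ℝ) : EReal)) Filter.atTop = 1 := by
  have h : Filter.Tendsto (fun u : ℝ => 1 - Real.exp ε / u) Filter.atTop (nhds 1) := by
    simpa using tendsto_const_nhds.sub
      ((tendsto_const_nhds (x := Real.exp ε)).div_atTop Filter.tendsto_id)
  have h' : Filter.Tendsto (fun u : ℝ => epsDFun ε u / u) Filter.atTop (nhds 1) := by
    refine h.congr' ?_
    filter_upwards [Filter.eventually_ge_atTop (Real.exp ε)] with u hu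
    have : 0 < u := (Real.exp_pos _).trans_le hu
    rw [epsDFun, max_eq_left (sub_nonneg.2 hu)]
    field_simp
  exact ((continuous_coe_real_ereal.tendsto 1).comp h').limsup_eq

theorem sub_exp_mul_le_divTerm (ε : ℝ≥0) {p q : ℝ} (hq : 0 ≤ q) :
    ((p - Real.exp ε * q : ℝ) : EReal) ≤ divTerm (epsDFun ε) p q := by
  unfold divTerm
  split_ifs with hq0 hp0 hp0
  · simp [hp0, hq0]
  · rw [limsup_epsDFun_div, mul_one, hq0, mul_zero, sub_zero]
  · refine le_trans ?_ (mul_nonneg (EReal.coe_nonneg.2 hq) (Filter.le_limsup_of_frequently_le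
      (Filter.Frequently.of_forall fun u => EReal.coe_nonneg.2 (epsDFun_nonneg ε u))))
    rw [hp0, zero_sub]
    exact EReal.coe_nonpos.2 (neg_nonpos.2 (mul_nonneg (Real.exp_pos _).le hq))
  · refine EReal.coe_le_coe_iff.2 ?_
    calc p - Real.exp ε * q = q * (p / q - Real.exp ε) := by field_simp
      _ ≤ q * epsDFun ε (p / q) := mul_le_mul_of_nonneg_left (le_max_left _ _) hq

/-- A bound on the `ε`-distance is differential privacy: the bound
`μ a ≤ exp ε * ν a + (positive part of the summand at a)` is summed over the event. -/
theorem toOuterMeasure_le_of_fDiv_epsDFun_le (ε : ℝ≥0) (δ : ℝ≥0∞) {A : Type} {μ ν : PMF A}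
    (h : fDiv (epsDFun ε) μ ν ≤ (δ : EReal)) (S : Set A) :
    μ.toOuterMeasure S ≤ ENNReal.ofReal (Real.exp ε) * ν.toOuterMeasure S + δ := by
  set t : A → EReal := fun a => divTerm (epsDFun ε) (μ a).toReal (ν a).toReal
  have ht (a : A) : 0 ≤ t a :=
    divTerm_nonneg (epsDFun_nonneg ε) ENNReal.toReal_nonneg ENNReal.toReal_nonneg
  have hδ : ∑' a, (t a).toENNReal ≤ δ := by
    have h_neg (a : A) : (-t a).toENNReal = 0 :=
      EReal.toENNReal_of_nonpos (by simpa using ht a)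
    have h_eq : fDiv (epsDFun ε) μ ν = ((∑' a, (t a).toENNReal : ℝ≥0∞) : EReal) := by
      change _ - ((∑' a, (-t a).toENNReal : ℝ≥0∞) : EReal) = _
      simp [h_neg, t]
    rw [h_eq] at h
    exact EReal.coe_ennreal_le_coe_ennreal_iff.1 h
  have h_point (a : A) : μ a ≤ ENNReal.ofReal (Real.exp ε) * ν a + (t a).toENNReal := by
    have h₁ := EReal.toENNReal_le_toENNReal (sub_exp_mul_le_divTerm ε
      (p := (μ a).toReal) (ENNReal.toReal_nonneg (a := ν a)))
    rw [EReal.toENNReal_of_ne_top (EReal.coe_ne_top _), EReal.toReal_coe,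
      ENNReal.ofReal_sub _ (mul_nonneg (Real.exp_pos _).le ENNReal.toReal_nonneg),
      ENNReal.ofReal_mul (Real.exp_pos _).le, ENNReal.ofReal_toReal (μ.apply_ne_top a),
      ENNReal.ofReal_toReal (ν.apply_ne_top a), tsub_le_iff_left] at h₁
    exact h₁
  rw [PMF.toOuterMeasure_apply, PMF.toOuterMeasure_apply]
  calc ∑' a, S.indicator μ a
      ≤ ∑' a, (ENNReal.ofReal (Real.exp ε) * S.indicator ν a + (t a).toENNReal) := by
        refine ENNReal.tsum_le_tsum fun a => ?_
        by_cases ha : a ∈ S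
        · simpa only [Set.indicator_of_mem ha] using h_point a
        · simp [Set.indicator_of_notMem ha]
    _ = ENNReal.ofReal (Real.exp ε) * ∑' a, S.indicator ν a + ∑' a, (t a).toENNReal := by
        rw [ENNReal.tsum_add, ENNReal.tsum_mul_left]
    _ ≤ _ := by gcongr

/-! ### Liftings -/

theorem bind_congr_of_ne_zero {A B : Type} {μ : PMF A} {M N : A → PMF B}
    (h : ∀ a, μ a ≠ 0 → M a = N a) : μ.bind M = μ.bind N := by
  ext b
  rw [PMF.bind_apply, PMF.bind_apply]
  refine tsum_congr fun a => ?_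
  by_cases ha : μ a = 0
  · simp [ha]
  · rw [h a ha]

theorem map_congr_of_ne_zero {A B : Type} {μ : PMF A} {g h : A → B}
    (H : ∀ a, μ a ≠ 0 → g a = h a) : μ.map g = μ.map h :=
  bind_congr_of_ne_zero fun a ha => congrArg PMF.pure (H a ha)

/-- For the equality relation both witnesses of a lifting live on the diagonal, so that they are
determined by the two given distributions. -/
theorem lifting_eq_iff (f : ℝ → ℝ) (δ : ℝ≥0∞) {A : Type} (μ ν : PMF A) :
    Lifting f δ Eq μ ν ↔ fDiv f μ ν ≤ (δ : EReal) := by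
  have h_inj : Function.Injective fun a : A => (a, a) := fun _ _ h => congrArg Prod.fst h
  constructor
  · rintro ⟨μL, μR, hL, hR, rfl, rfl, h⟩
    have eL : (μL.map Prod.fst).map (fun a => (a, a)) = μL := by
      rw [PMF.map_comp]
      exact (map_congr_of_ne_zero (h := id) fun p hp =>
        congrArg (Prod.mk p.1) (hL p.1 p.2 hp)).trans
        (PMF.map_id _)
    have eR : (μR.map Prod.snd).map (fun a => (a, a)) = μR := by
      rw [PMF.map_comp]
      exact (map_congr_of_ne_zero (h := id) fun p hp =>
        congrArg (·, p.2) (hR p.1 p.2 hp).symm).trans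
        (PMF.map_id _)
    rwa [← fDiv_map_injective f h_inj, eL, eR]
  · intro h
    have h_supp (ρ : PMF A) (a b : A) (hab : (ρ.map fun a => (a, a)) (a, b) ≠ 0) : a = b := by
      obtain ⟨c, _, hc⟩ := (PMF.mem_support_map_iff _ _ _).1 ((PMF.mem_support_iff _ _).2 hab)
      exact (congrArg Prod.fst hc).symm.trans (congrArg Prod.snd hc)
    refine ⟨μ.map fun a => (a, a), ν.map fun a => (a, a), h_supp μ, h_supp ν, ?_, ?_, ?_⟩
    · rw [PMF.map_comp]
      exact PMF.map_id _
    · rw [PMF.map_comp]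
      exact PMF.map_id _
    · rwa [fDiv_map_injective f h_inj]

theorem Lifting.pure {f : ℝ → ℝ} (hf : ClassF f) (δ : ℝ≥0∞) {A B : Type} {Ψ : A → B → Prop}
    {a : A} {b : B} (h : Ψ a b) : Lifting f δ Ψ (PMF.pure a) (PMF.pure b) := by
  have h_supp (a' : A) (b' : B) (h' : PMF.pure (a, b) (a', b') ≠ 0) : Ψ a' b' := by
    obtain ⟨rfl, rfl⟩ := Prod.mk.inj ((PMF.mem_support_pure_iff _ _).1
      ((PMF.mem_support_iff _ _).2 h'))
    exact h
  refine ⟨PMF.pure (a, b), PMF.pure (a, b), h_supp, h_supp, PMF.pure_map _ _, PMF.pure_map _ _, ?_⟩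
  rw [fDiv_self hf]
  exact EReal.coe_ennreal_nonneg δ

/-- The liftings of a relation that is empty are empty, since distributions have mass. -/
theorem Lifting.exists_rel {f : ℝ → ℝ} {δ : ℝ≥0∞} {A B : Type} {Ψ : A → B → Prop} {μ : PMF A}
    {ν : PMF B} (h : Lifting f δ Ψ μ ν) : ∃ a b, Ψ a b := by
  obtain ⟨μL, _, hL, _⟩ := h
  obtain ⟨⟨a, b⟩, hab⟩ := μL.support_nonempty
  exact ⟨a, b, hL a b hab⟩

theorem Lifting.mono {f g : ℝ → ℝ} {δ δ' : ℝ≥0∞} {A B : Type} {Ψ Ψ' : A → B → Prop} {μ : PMF A}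
    {ν : PMF B} (h : Lifting f δ Ψ μ ν) (hΨ : ∀ a b, Ψ a b → Ψ' a b)
    (hfg : ∀ x, 0 < x → g x ≤ f x) (hδ : δ ≤ δ') : Lifting g δ' Ψ' μ ν := by
  obtain ⟨μL, μR, hL, hR, h₁, h₂, h⟩ := h
  exact ⟨μL, μR, fun a b hab => hΨ a b (hL a b hab), fun a b hab => hΨ a b (hR a b hab), h₁, h₂,
    (fDiv_mono hfg μL μR).trans (h.trans (EReal.coe_ennreal_le_coe_ennreal_iff.2 hδ))⟩

/-- Composability lifts to liftings.  The witnesses for the continuations exist only at related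
pairs; elsewhere, where the supremum in the definition of composability also ranges, the witnesses
at one fixed related pair are used. -/
theorem Lifting.bind {f₁ f₂ f₃ : ℝ → ℝ} (hf : Composable f₁ f₂ f₃) {δ₁ δ₂ : ℝ≥0∞}
    {A B C D : Type} {Ψ : A → B → Prop} {Ψ' : C → D → Prop} {μ : PMF A} {ν : PMF B}
    {M : A → PMF C} {N : B → PMF D} (h : Lifting f₁ δ₁ Ψ μ ν)
    (hMN : ∀ a b, Ψ a b → Lifting f₂ δ₂ Ψ' (M a) (N b)) :
    Lifting f₃ (δ₁ + δ₂) Ψ' (μ.bind M) (ν.bind N) := by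
  classical
  obtain ⟨a₀, b₀, h₀⟩ := h.exists_rel
  obtain ⟨μL, μR, hL, hR, rfl, rfl, h⟩ := h
  have h_wit (p : A × B) : ∃ ρL ρR : PMF (C × D),
      (∀ c d, ρL (c, d) ≠ 0 → Ψ' c d) ∧ (∀ c d, ρR (c, d) ≠ 0 → Ψ' c d) ∧
      (Ψ p.1 p.2 → ρL.map Prod.fst = M p.1 ∧ ρR.map Prod.snd = N p.2) ∧
      fDiv f₂ ρL ρR ≤ (δ₂ : EReal) := by
    by_cases hp : Ψ p.1 p.2
    · obtain ⟨ρL, ρR, h₁, h₂, h₃, h₄, h₅⟩ := hMN _ _ hp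
      exact ⟨ρL, ρR, h₁, h₂, fun _ => ⟨h₃, h₄⟩, h₅⟩
    · obtain ⟨ρL, ρR, h₁, h₂, _, _, h₅⟩ := hMN _ _ h₀
      exact ⟨ρL, ρR, h₁, h₂, fun h => absurd h hp, h₅⟩
  choose ML MR hML hMR h_marg h_div using h_wit
  have h_supp (ρ : PMF (A × B)) {K : A × B → PMF (C × D)}
      (hK : ∀ p c d, K p (c, d) ≠ 0 → Ψ' c d) (c : C) (d : D)
      (hcd : (ρ.bind K) (c, d) ≠ 0) : Ψ' c d := by
    obtain ⟨p, _, hp⟩ := (PMF.mem_support_bind_iff _ _ _).1 ((PMF.mem_support_iff _ _).2 hcd)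
    exact hK p c d hp
  refine ⟨μL.bind ML, μR.bind MR, h_supp μL hML, h_supp μR hMR, ?_, ?_, ?_⟩
  · rw [PMF.map_bind, PMF.bind_map]
    exact bind_congr_of_ne_zero fun p hp => (h_marg p (hL p.1 p.2 hp)).1
  · rw [PMF.map_bind, PMF.bind_map]
    exact bind_congr_of_ne_zero fun p hp => (h_marg p (hR p.1 p.2 hp)).2
  · rw [EReal.coe_ennreal_add]
    exact (hf.2.2.2 _ _ μL μR ML MR).trans (add_le_add h (iSup_le h_div))

/-! ### Soundness of subtyping and typing -/

/-- Under a valid environment, a subtype denotes a smaller relation. -/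
theorem SubTy.sound (I : Model) {Γ : List STy} {G : REnv Γ} {τ : STy} {T U : RTy (dbl Γ) τ}
    (h : SubTy I G T U) (θ : Env (dbl Γ)) (hθ : G.Valid I θ) (d₁ d₂ : τ.Sem)
    (hd : T.den I θ d₁ d₂) : U.den I θ d₁ d₂ := by
  induction h with
  | refl => exact hd
  | trans _ _ ih₁ ih₂ => exact ih₂ θ hθ _ _ (ih₁ θ hθ _ _ hd)
  | left =>
    simp only [RTy.den] at hd
    exact hd.1
  | right φ _ hφ ih =>
    simp only [RTy.den]
    exact ⟨ih θ hθ _ _ hd, hφ (d₁, d₂, θ) (by simpa only [REnv.Valid] using ⟨hθ, hd⟩)⟩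
  | prod _ _ ih₁ ih₂ =>
    simp only [RTy.den] at hd ⊢
    intro a₁ a₂ ha
    exact ih₂ (a₁, a₂, θ) (by simpa only [REnv.Valid] using ⟨hθ, ha⟩) _ _
      (hd a₁ a₂ (ih₁ θ hθ _ _ ha))
  | mon _ _ _ h ih =>
    simp only [RTy.den] at hd ⊢
    -- The side condition speaks about related values; the lifting provides some.
    obtain ⟨a, b, hab⟩ := hd.exists_rel
    obtain ⟨hf, hδ, _⟩ := h θ a b (by simpa only [REnv.Valid] using ⟨hθ, hab⟩)
    exact hd.mono (ih θ hθ) hf hδ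

/-- A guarded `letrec` satisfies its equation: `Classical.epsilon` picks an actual fixed point. -/
theorem Tm.den_letrec (I : Model) {Γ : List STy} {σ τ : STy} {e : Tm (.arr σ τ :: σ :: Γ) τ}
    {m : σ.Sem → ℕ} (h : Guarded I m e) (γ : Env Γ) (a : σ.Sem) :
    (Tm.letrec e).den I γ a = e.den I ((Tm.letrec e).den I γ, a, γ) := by
  have h_ex := exists_fixedPoint_of_measure m (fun (g : σ.Sem → τ.Sem) a => e.den I (g, a, γ))
    fun a g g' hg => h γ a g g' hg
  exact Classical.epsilon_spec h_ex a

/-- The assumption on recursive calls in the rule for `letrec`, semantically. -/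
theorem RTy.den_recCall (I : Model) {Ξ : List STy} {σ τ : STy} (hσ : σ.Data) (m : σ.Sem → ℕ)
    (T : RTy Ξ σ) (U : RTy (σ :: σ :: Ξ) τ) (d₁ d₂ : σ.Sem) (θ : Env Ξ)
    (g₁ g₂ : σ.Sem → τ.Sem)
    (h : ∀ a₁ a₂, T.den I θ a₁ a₂ → m a₁ < m d₁ → m a₂ < m d₂ →
      U.den I (a₁, a₂, θ) (g₁ a₁) (g₂ a₂)) :
    (RTy.recCall hσ m T U).den I (d₁, d₂, θ) g₁ g₂ := by
  simp only [RTy.recCall, RTy.den, Asrt.den]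
  rintro a₁ a₂ ⟨hT, h₁, h₂⟩
  rw [RTy.den_wk] at hT
  rw [U.den_subst I (γ := (a₁, a₂, θ))
    (Subst.den_cons I (Subst.den_cons I (γ := θ) (fun _ _ => rfl) _) _)]
  exact h a₁ a₂ hT h₁ h₂

/-- Since liftings of equality are divergence bounds, the types of mechanisms, of `observe` and of
`ran` hold as soon as the bound that they state does. -/
theorem RTy.den_mon_eqv (I : Model) {Ξ : List STy} {v : VTy}
    (f : Tm Ξ (.arr (.base .real) (.base .real))) (δ : Tm Ξ (.base .epreal)) (θ : Env Ξ)
    (μ ν : PMF v.Sem) :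
    (RTy.mon f δ (.eqv v)).den I θ μ ν ↔
      fDiv (f.den I θ) μ ν ≤ ((δ.den I θ : ℝ≥0∞) : EReal) := by
  simp only [RTy.den, RTy.den_eqv, lifting_eq_iff]

theorem RTy.den_ref_divD (I : Model) {Ξ : List STy} {b : BTy}
    (f : Tm Ξ (.arr (.base .real) (.base .real))) (δ : Tm Ξ (.base .epreal)) (θ : Env Ξ)
    (s₁ s₂ : Sym b) :
    (RTy.ref (.val (.dist b)) (.divD f.wk.wk (.var .z) (.var (.s .z)) δ.wk.wk)).den I θ s₁ s₂ ↔
      fDiv (f.den I θ) (s₁.ran I.prec) (s₂.ran I.prec) ≤ ((δ.den I θ : ℝ≥0∞) : EReal) := by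
  simp only [RTy.den, Asrt.den, Tm.den, Var.den, true_and]
  rw [Tm.den_wk_wk (σ := .dist b), Tm.den_wk_wk (σ := .dist b)]

/-- Related valuations send the two expressions of a derivable judgement to related values.  The case
of `letrec` needs a second induction, on the measure of the left argument, to justify the assumption
on recursive calls. -/
theorem HasTy.sound (I : Model) {Γ : List STy} {G : REnv Γ} {τ : STy} {e₁ e₂ : Tm Γ τ}
    {T : RTy (dbl Γ) τ} (h : HasTy I G e₁ e₂ T) (θ : Env (dbl Γ)) (hθ : G.Valid I θ) :
    T.den I θ (e₁.den I (Env.left θ)) (e₂.den I (Env.right θ)) := by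
  induction h with
  | @var Γ τ G x => exact G.den_lookup I x θ hθ
  | const τ h c => exact RTy.den_plain I τ h θ c c
  | lam _ ih =>
    simp only [RTy.den]
    exact fun d₁ d₂ hd => ih (d₁, d₂, θ) (by simpa only [REnv.Valid] using ⟨hθ, hd⟩)
  | app _ _ ih₁ ih₂ =>
    have h₁ := ih₁ θ hθ
    simp only [RTy.den] at h₁
    rw [RTy.den_inst, Tm.den_left, Tm.den_right]
    exact h₁ _ _ (ih₂ θ hθ)
  | @letrec Γ σ τ G e₁ e₂ T U hσ m hg₁ hg₂ _ ih =>
    simp only [RTy.den]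
    intro d₁
    induction hn : m d₁ using Nat.strong_induction_on generalizing d₁ with
    | _ n ihn =>
      intro d₂ hd
      subst hn
      rw [Tm.den_letrec I hg₁, Tm.den_letrec I hg₂]
      have h_rec := RTy.den_recCall I hσ m T U d₁ d₂ θ _ _
        fun a₁ a₂ ha h₁ _ => ihn (m a₁) h₁ a₁ rfl a₂ ha
      have := ih ((Tm.letrec e₁).den I (Env.left θ), (Tm.letrec e₂).den I (Env.right θ),
        d₁, d₂, θ) (by simpa only [REnv.Valid] using ⟨⟨hθ, hd⟩, h_rec⟩)
      rwa [RTy.den_wk (σ := .arr σ τ)] at this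
  | sub _ hs ih => exact hs.sound I θ hθ _ _ (ih θ hθ)
  | ref φ _ hφ ih =>
    have := hφ θ hθ
    rw [Tm.den_left, Tm.den_right] at this
    simp only [RTy.den]
    exact ⟨ih θ hθ, this⟩
  | conv _ h₁ h₂ ih =>
    rw [h₁, h₂]
    exact ih θ hθ
  | @caseBool Γ τ G e e' e₁ e₂ e₁' e₂' T _ h_iff _ _ _ ih₁ ih₂ =>
    have h_iff := h_iff θ hθ
    simp only [REnv.Valid, Asrt.den, Tm.den_left, Tm.den_right, Tm.boolC, Tm.den] at h_iff ih₁ ih₂ ⊢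
    rcases h : e.den I (Env.left θ) with _ | _ <;> rcases h' : e'.den I (Env.right θ) with _ | _
    · exact ih₂ θ ⟨hθ, h, h'⟩
    · simp [h, h'] at h_iff
    · simp [h, h'] at h_iff
    · exact ih₁ θ ⟨hθ, h, h'⟩
  | @caseNat Γ τ G e e' e₁ e₁' e₂ e₂' T _ h_iff _ _ _ ih₁ ih₂ =>
    have h_iff := h_iff θ hθ
    simp only [REnv.Valid, RTy.den, Asrt.den, Tm.den_left, Tm.den_right, Tm.zeroC, Tm.den]
      at h_iff ih₁ ih₂ ⊢
    rcases h : e.den I (Env.left θ) with _ | n <;> rcases h' : e'.den I (Env.right θ) with _ | n'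
    · exact ih₁ θ ⟨hθ, h, h'⟩
    · simp [h, h'] at h_iff
    · simp [h, h'] at h_iff
    · have := ih₂ (n, n', θ) ⟨⟨hθ, trivial⟩, (e.den_wk I _ _).trans h, (e'.den_wk I _ _).trans h'⟩
      rwa [RTy.den_wk (σ := .base .nat)] at this
  | @caseList Γ τ b G e e' e₁ e₁' e₂ e₂' T _ h_iff _ _ _ ih₁ ih₂ =>
    have h_iff := h_iff θ hθ
    simp only [REnv.Valid, RTy.den, Asrt.den, Tm.den_left, Tm.den_right, Tm.nilC, Tm.den]
      at h_iff ih₁ ih₂ ⊢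
    rcases h : e.den I (Env.left θ) with _ | ⟨x, t⟩ <;>
      rcases h' : e'.den I (Env.right θ) with _ | ⟨x', t'⟩
    · exact ih₁ θ ⟨hθ, h, h'⟩
    · simp [h, h'] at h_iff
    · simp [h, h'] at h_iff
    · have := ih₂ (t, t', x, x', θ) ⟨⟨⟨hθ, trivial⟩, trivial⟩,
        (e.den_wk_wk I _ _ _).trans h, (e'.den_wk_wk I _ _ _).trans h'⟩
      rwa [RTy.den_wk (σ := .base (.list b)), RTy.den_wk (σ := .base b)] at this
  | @caseBoolL Γ τ G e e₁ e₂ e' T _ _ ih₁ ih₂ =>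
    simp only [REnv.Valid, Asrt.den, Tm.den_left, Tm.boolC, Tm.den] at ih₁ ih₂ ⊢
    rcases h : e.den I (Env.left θ) with _ | _
    · exact ih₂ θ ⟨hθ, h⟩
    · exact ih₁ θ ⟨hθ, h⟩
  | @caseNatL Γ τ G e e₁ e' e₂ T _ _ ih₁ ih₂ =>
    simp only [REnv.Valid, RTy.den, Asrt.den, Tm.den_left, Tm.zeroC, Tm.den] at ih₁ ih₂ ⊢
    rcases h : e.den I (Env.left θ) with _ | n
    · exact ih₁ θ ⟨hθ, h⟩
    -- The variables of the pattern are bound on both sides, but the other side ignores them.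
    · have := ih₂ (n, n, θ) ⟨⟨hθ, trivial⟩, (e.den_wk I _ _).trans h⟩
      have h' : e'.wk.den I (Env.right (Γ := .base .nat :: Γ) (n, n, θ)) = e'.den I (Env.right θ) :=
        e'.den_wk I _ _
      rwa [RTy.den_wk (σ := .base .nat), h'] at this
  | @caseListL Γ τ b G e e₁ e' e₂ T _ _ ih₁ ih₂ =>
    simp only [REnv.Valid, RTy.den, Asrt.den, Tm.den_left, Tm.nilC, Tm.den] at ih₁ ih₂ ⊢
    rcases h : e.den I (Env.left θ) with _ | ⟨x, t⟩
    · exact ih₁ θ ⟨hθ, h⟩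
    -- The variables of the pattern are bound on both sides, but the other side ignores them.
    · have := ih₂ (t, t, x, x, θ) ⟨⟨⟨hθ, trivial⟩, trivial⟩, (e.den_wk_wk I _ _ _).trans h⟩
      have h' : e'.wk.wk.den I (Env.right (Γ := .base (.list b) :: .base b :: Γ) (t, t, x, x, θ)) =
          e'.den I (Env.right θ) := e'.den_wk_wk I _ _ _
      rwa [RTy.den_wk (σ := .base (.list b)), RTy.den_wk (σ := .base b), h'] at this
  | @caseBoolR Γ τ G e e₁ e₂ e' T _ _ ih₁ ih₂ =>
    simp only [REnv.Valid, Asrt.den, Tm.den_right, Tm.boolC, Tm.den] at ih₁ ih₂ ⊢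
    rcases h : e.den I (Env.right θ) with _ | _
    · exact ih₂ θ ⟨hθ, h⟩
    · exact ih₁ θ ⟨hθ, h⟩
  | @caseNatR Γ τ G e e₁ e' e₂ T _ _ ih₁ ih₂ =>
    simp only [REnv.Valid, RTy.den, Asrt.den, Tm.den_right, Tm.zeroC, Tm.den] at ih₁ ih₂ ⊢
    rcases h : e.den I (Env.right θ) with _ | n
    · exact ih₁ θ ⟨hθ, h⟩
    -- The variables of the pattern are bound on both sides, but the other side ignores them.
    · have := ih₂ (n, n, θ) ⟨⟨hθ, trivial⟩, (e.den_wk I _ _).trans h⟩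
      have h' : e'.wk.den I (Env.left (Γ := .base .nat :: Γ) (n, n, θ)) = e'.den I (Env.left θ) :=
        e'.den_wk I _ _
      rwa [RTy.den_wk (σ := .base .nat), h'] at this
  | @caseListR Γ τ b G e e₁ e' e₂ T _ _ ih₁ ih₂ =>
    simp only [REnv.Valid, RTy.den, Asrt.den, Tm.den_right, Tm.nilC, Tm.den] at ih₁ ih₂ ⊢
    rcases h : e.den I (Env.right θ) with _ | ⟨x, t⟩
    · exact ih₁ θ ⟨hθ, h⟩
    -- The variables of the pattern are bound on both sides, but the other side ignores them.
    · have := ih₂ (t, t, x, x, θ) ⟨⟨⟨hθ, trivial⟩, trivial⟩, (e.den_wk_wk I _ _ _).trans h⟩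
      have h' : e'.wk.wk.den I (Env.left (Γ := .base (.list b) :: .base b :: Γ) (t, t, x, x, θ)) =
          e'.den I (Env.left θ) := e'.den_wk_wk I _ _ _
      rwa [RTy.den_wk (σ := .base (.list b)), RTy.den_wk (σ := .base b), h'] at this
  | unitM δ hf _ ih =>
    have hf := hf θ hθ
    simp only [Asrt.den] at hf
    simp only [RTy.den]
    exact Lifting.pure hf _ (ih θ hθ)
  | @bindM Γ v w G e₁ e₁' e₂ e₂' T₁ T₂ f₁ f₂ f₃ δ₁ δ₂ _ hf _ ih₁ ih₂ =>
    have h₁ := ih₁ θ hθ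
    simp only [RTy.den] at h₁ ⊢
    refine Lifting.bind (hf θ hθ) h₁ fun a b hab => ?_
    have h₂ := ih₂ (a, b, θ) (by simpa only [REnv.Valid] using ⟨hθ, hab⟩)
    rw [RTy.den_wk (σ := .val v)] at h₂
    simp only [RTy.den] at h₂
    exact h₂
  | infer _ ih =>
    rw [RTy.den_ref_divD]
    simp only [Tm.den, I.exact_algInf]
    exact (RTy.den_mon_eqv I _ _ θ _ _).1 (ih θ hθ)
  | ran _ ih => exact (RTy.den_mon_eqv I _ _ θ _ _).2 ((RTy.den_ref_divD I _ _ θ _ _).1 (ih θ hθ))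
  | observe _ _ h | lapMech _ _ h | gaussMech _ _ h | expMech _ _ _ h =>
    have := h θ hθ
    simp only [Asrt.den] at this
    rw [Tm.den_left, Tm.den_right] at this
    exact (RTy.den_mon_eqv I _ _ θ _ _).2 this
  | uniform | bernoulli | normal | beta | getParams => simp only [RTy.den]

end PrivInfer

theorem mainTheorem2 (I : PrivInfer.Model) (σ : PrivInfer.STy) (hσ : σ.Data) (τ : PrivInfer.VTy)
    (Φ : PrivInfer.Asrt [σ, σ])
    (ε : PrivInfer.Tm [] (.base .preal)) (δ : PrivInfer.Tm [] (.base .epreal))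
    (e : PrivInfer.Tm [] (.arr σ (.mon τ)))
    (he : PrivInfer.HasTy I .nil e e
      (.pi (.ref (.plain σ hσ) Φ) (.mon (.epsD ε.closed) δ.closed (.eqv τ)))) :
    PrivInfer.IsDP (fun d₁ d₂ => Φ.den I (d₁, d₂, ())) (e.den I ()) (ε.den I ()) (δ.den I ()) := by
  intro d d' hΦ S
  have h := he.sound I () trivial
  simp only [PrivInfer.RTy.den] at h
  have h_lift := h d d' ⟨PrivInfer.RTy.den_plain (Ξ := []) I σ hσ () d d', hΦ⟩
  rw [PrivInfer.RTy.den_eqv, PrivInfer.lifting_eq_iff] at h_lift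
  have h_eps : (PrivInfer.Tm.epsD (ε.closed (Γ := [σ, σ]))).den I (d, d', ()) =
      PrivInfer.epsDFun (ε.den I ()) := congrArg PrivInfer.epsDFun (ε.den_closed I _)
  rw [h_eps, δ.den_closed I] at h_lift
  exact PrivInfer.toOuterMeasure_le_of_fDiv_epsDFun_le _ _ h_lift S
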